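/- Let $\phi=\mathbf 1_{[0,1]}$, $\psi=\mathbf 1_{[0,1/2]}-\mathbf 1_{[1/2,1]}$, $\Lambda=\{(j,k):j\ge -1,\ k\in\mathbb Z\}$, and let $\varphi_\lambda(x)=\phi(x-k)$ for $\lambda=(-1,k)$ and $\varphi_\lambda(x)=2^{j/2}\psi(2^jx-k)$ for $\lambda=(j,k)$, $j\ge 0$, be the Haar basis. For an intensity $f\ge 0$ in $\mathbb L_1(\mathbb R)\cap\mathbb L_2(\mathbb R)$ and $n\ge 2$, let $N$ be a Poisson process on $\mathbb R$ with mean measure $n f(x)\,dx$, and let $dN=\sum_{T\in N}\delta_T$. Fix $c\ge 1$, $\gamma>c$ and $c'=-c$, and let $j_0=j_0(n)$ be the integer such that $2^{j_0}\le n^c(\log n)^{c'}<2^{j_0+1}$. Put $$\hat\beta_\lambda=\frac1n\int\varphi_\lambda\,dN,\qquad \hat V_{\lambda,n}=\frac1{n^2}\int\varphi_\lambda^2\,dN,$$ $$\tilde V_{\lambda,n}=\hat V_{\lambda,n}+\sqrt{2\gamma\log n\,\hat V_{\lambda,n}\frac{\|\varphi_\lambda\|_\infty^2}{n^2}}+3\gamma\log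 n\,\frac{\|\varphi_\lambda\|_\infty^2}{n^2},\qquad \eta_{\lambda,\gamma}=\sqrt{2\gamma\tilde V_{\lambda,n}\log n}+\frac{\gamma\log n}{3n}\|\varphi_\lambda\|_\infty,$$ and let $$\tilde f^H_{n,\gamma}=\sum_{\lambda=(j,k)\in\Lambda,\ j\le j_0}\hat\beta_\lambda\mathbf 1_{\{|\hat\beta_\lambda|\ge\eta_{\lambda,\gamma}\}}\varphi_\lambda$$ be the Haar thresholding estimator. For the rate $\rho_{n,s}=(\log n/n)^s$, the maxiset $MS(\tilde f^H_\gamma,\rho_s)$ is the set of all intensities $f\in\mathbb L_1\cap\mathbb L_2$ such that $$\sup_{n\ge 2}\ \rho_{n,s}^{-2}\,\mathbb E\|\tilde f^H_{n,\gamma}-f\|_2^2<\infty .$$ Let $0<s<1/6$, $0<\beta\le\frac12(1-6s)$ and $f_\beta(x)=x^{-\beta}\mathbf 1_{[0,1]}(x)$. Then there is a constant $c_0$, depending only on $s$ and $\beta$, such that for every $c\ge\max(1,c_0)$ and every $\gamma>c$ one has $f_\beta\in MS(\tilde f^H_\gamma,\rho_s)$ (with $c'=-c$). Moreover $f_\beta\notin\mathbb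 L_\infty$. -/

import Mathlib

open MeasureTheory ProbabilityTheory Set
open scoped ENNReal NNReal

universe u

namespace HaarPoisson

/-! ### Poisson processes -/

/-- `N` is a Poisson process on `X` with mean measure `μ`, defined on the probability space
`(Ω, P)`: a random countable subset of `X` such that the number of its points in a measurable set
`A` is a random variable with the Poisson distribution of parameter `μ A` (almost surely infinite if
`μ A = ∞`), and the numbers of points in finitely many disjoint measurable sets are independent. -/
structure IsPoissonProcess {Ω X : Type*} [MeasurableSpace Ω] [MeasurableSpace X]
    (N : Ω → Set X) (P : Measure Ω) (μ : Measure X) : Prop where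
  countable : ∀ ω, (N ω).Countable
  measurable_count : ∀ A : Set X, MeasurableSet A → Measurable fun ω => (N ω ∩ A).encard
  law_count : ∀ A : Set X, MeasurableSet A → μ A ≠ ∞ →
    P.map (fun ω => (N ω ∩ A).encard) =
      (poissonMeasure (μ A).toNNReal).map (Nat.cast : ℕ → ℕ∞)
  count_eq_top : ∀ A : Set X, MeasurableSet A → μ A = ∞ → ∀ᵐ ω ∂P, (N ω ∩ A).encard = ⊤
  indep_count : ∀ (m : ℕ) (A : Fin m → Set X), (∀ i, MeasurableSet (A i)) →
    Pairwise (fun i j => Disjoint (A i) (A j)) → iIndepFun (fun i ω => (N ω ∩ A i).encard) P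

/-- The mean measure `n f(x) dx` of the process observed at stage `n` when the intensity is `f`. -/
noncomputable def meanMeasure (f : ℝ → ℝ) (n : ℕ) : Measure ℝ :=
  (n : ℝ≥0∞) • volume.withDensity fun x => ENNReal.ofReal (f x)

/-- The discrete measure `dN = ∑_{T ∈ N} δ_T` attached to a set of points. -/
noncomputable def pointMeasure (S : Set ℝ) : Measure ℝ :=
  Measure.sum fun T : S => Measure.dirac (T : ℝ)

/-! ### The Haar basis -/

/-- The father function `1_{[0,1]}`. -/
noncomputable def haarPhi : ℝ → ℝ := (Icc (0 : ℝ) 1).indicator 1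

/-- The mother function `1_{[0,1/2]} - 1_{[1/2,1]}`. -/
noncomputable def haarPsi : ℝ → ℝ :=
  (Icc (0 : ℝ) (1 / 2)).indicator 1 - (Icc (1 / 2 : ℝ) 1).indicator 1

/-- The index set `Λ = {(j, k) : j ≥ -1, k ∈ ℤ}`. -/
abbrev Index : Type := {l : ℤ × ℤ // -1 ≤ l.1}

/-- The Haar function `φ_l`: `φ(x - k)` if `l = (-1, k)`, and `2 ^ (j / 2) ψ(2 ^ j x - k)` if
`l = (j, k)` with `j ≥ 0`. -/
noncomputable def haar (l : Index) (x : ℝ) : ℝ :=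
  if l.1.1 = -1 then haarPhi (x - l.1.2)
  else (2 : ℝ) ^ ((l.1.1 : ℝ) / 2) * haarPsi ((2 : ℝ) ^ l.1.1 * x - l.1.2)

/-- `‖φ_l‖_∞`. -/
noncomputable def haarSup (l : Index) : ℝ := (eLpNorm (haar l) ∞ volume).toReal

/-! ### The thresholding estimator -/

/-- The natural estimator `(1 / n) ∫ φ_l dN` of the coefficient of index `l`. -/
noncomputable def betaHat (n : ℕ) (S : Set ℝ) (l : Index) : ℝ :=
  1 / (n : ℝ) * ∫ x, haar l x ∂pointMeasure S

/-- The variance estimator `(1 / n ^ 2) ∫ φ_l ^ 2 dN`. -/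
noncomputable def vHat (n : ℕ) (S : Set ℝ) (l : Index) : ℝ :=
  1 / (n : ℝ) ^ 2 * ∫ x, haar l x ^ 2 ∂pointMeasure S

/-- The overestimate of the variance that enters the threshold. -/
noncomputable def vTilde (γ : ℝ) (n : ℕ) (S : Set ℝ) (l : Index) : ℝ :=
  vHat n S l
    + Real.sqrt (2 * γ * Real.log n * vHat n S l * (haarSup l ^ 2 / (n : ℝ) ^ 2))
    + 3 * γ * Real.log n * (haarSup l ^ 2 / (n : ℝ) ^ 2)

/-- The data-driven threshold. -/
noncomputable def threshold (γ : ℝ) (n : ℕ) (S : Set ℝ) (l : Index) : ℝ :=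
  Real.sqrt (2 * γ * vTilde γ n S l * Real.log n) + γ * Real.log n / (3 * n) * haarSup l

/-- The maximal resolution level: the integer `j₀` such that
`2 ^ j₀ ≤ n ^ c (log n) ^ c' < 2 ^ (j₀ + 1)`. -/
noncomputable def maxLevel (c c' : ℝ) (n : ℕ) : ℤ :=
  Int.log 2 ((n : ℝ) ^ c * Real.log n ^ c')

/-- `maxLevel` is characterised by the inequalities that define `j₀`. -/
theorem maxLevel_eq_iff (c c' : ℝ) {n : ℕ} (hn : 2 ≤ n) (j : ℤ) :
    maxLevel c c' n = j ↔
      (2 : ℝ) ^ j ≤ (n : ℝ) ^ c * Real.log n ^ c' ∧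
        (n : ℝ) ^ c * Real.log n ^ c' < (2 : ℝ) ^ (j + 1) := by
  have h1 : (1 : ℝ) < n := by exact_mod_cast hn
  have hlog : 0 < Real.log n := Real.log_pos h1
  have hr : 0 < (n : ℝ) ^ c * Real.log n ^ c' := by positivity
  have hlow := Int.zpow_log_le_self (b := 2) (by norm_num) hr
  have hup := Int.lt_zpow_succ_log_self (b := 2) (by norm_num) ((n : ℝ) ^ c * Real.log n ^ c')
  push_cast at hlow hup
  constructor
  · rintro rfl
    exact ⟨hlow, hup⟩
  · rintro ⟨h2, h3⟩
    have h4 := (zpow_lt_zpow_iff_right₀ (one_lt_two : (1 : ℝ) < 2)).1 (hlow.trans_lt h3)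
    have h5 := (zpow_lt_zpow_iff_right₀ (one_lt_two : (1 : ℝ) < 2)).1 (h2.trans_lt hup)
    unfold maxLevel
    omega

open Classical in
/-- The thresholded coefficient
`betaHat * 1_{|betaHat| ≥ threshold} * 1_{j ≤ j₀}` of index `l = (j, k)`. -/
noncomputable def betaTilde (γ c c' : ℝ) (n : ℕ) (S : Set ℝ) (l : Index) : ℝ :=
  if threshold γ n S l ≤ |betaHat n S l| ∧ l.1.1 ≤ maxLevel c c' n then betaHat n S l else 0

/-- The Haar thresholding estimator: at stage `n`, from the observed set of points `S`, it returns
the function `∑_l betaTilde_l φ_l`. At each point only finitely many terms are non-zero, since only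
the levels `-1 ≤ j ≤ j₀` contribute. -/
noncomputable def haarEstimator (γ c c' : ℝ) (n : ℕ) (S : Set ℝ) (x : ℝ) : ℝ :=
  ∑' l : Index, betaTilde γ c c' n S l * haar l x

/-! ### Maxisets -/

/-- The rate `(log n / n) ^ s`. -/
noncomputable def rate (s : ℝ) (n : ℕ) : ℝ := (Real.log n / n) ^ s

/-- The maxiset of an estimation procedure `fhat` for the rate `ρ` and the `L²`-loss: the
intensities `f ∈ L¹ ∩ L²` such that `sup_n ρ_n ^ (-2) E ‖fhat_n - f‖₂²` is finite, where
`fhat_n` is computed from a Poisson process with mean measure `n f(x) dx` (the expectation depends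
only on the law of the process, so every realization of it is allowed). The index `n` starts at `2`
because `log 1 = 0`. -/
def maxiset (fhat : ℕ → Set ℝ → ℝ → ℝ) (ρ : ℕ → ℝ) : Set (ℝ → ℝ) :=
  {f | (∀ᵐ x, 0 ≤ f x) ∧ MemLp f 1 volume ∧ MemLp f 2 volume ∧
    ∃ C : ℝ≥0, ∀ n : ℕ, 2 ≤ n →
      ∀ (Ω : Type u) [MeasurableSpace Ω] (P : Measure Ω) [IsProbabilityMeasure P]
        (N : Ω → Set ℝ), IsPoissonProcess N P (meanMeasure f n) →
        ∫⁻ ω, eLpNorm (fun x => fhat n (N ω) x - f x) 2 volume ^ 2 ∂P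
          ≤ C * ENNReal.ofReal (ρ n) ^ 2}

/-- The intensity `f_β(x) = x ^ (-β) 1_{[0,1]}(x)`. -/
noncomputable def fBeta (β : ℝ) : ℝ → ℝ := (Icc (0 : ℝ) 1).indicator fun x => x ^ (-β)

end HaarPoisson

namespace HaarPoisson

/-! ### Poisson integrals -/

/-! Off the dyadic rationals, which the process almost surely avoids, a Haar function is a constant
times `±1` on the two halves of a dyadic interval. If `A` and `B` count the points in the halves,
the empirical coefficient is `(2 ^ (j / 2) / n) (A - B)`, and its threshold is the same factor times
a function of `A + B` and `x = γ log n` (`betaTilde_eq`). The problem is therefore about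
thresholding a difference of two Poisson variables, with means `p` and `q`.

Two risk bounds for that scalar problem carry the proof. The oracle inequality
`lintegral_sq_keptDiff_sub_le` bounds the risk by `min ((p - q) ^ 2) (90 x (p + q))` plus a
remainder of order `exp (-x / 128)`, which is at most `n ^ (-20)` times the same constant once `γ ≥
2560`; it serves the levels with `2 ^ j ≤ n ^ 4`. On finer levels the means are tiny, while keeping
a coefficient requires at least `x` points in one half; `lintegral_sq_keptDiff_le` turns this into a
bound by a high power of the means, so these levels are negligible however large `c` is.

For `x ^ (-β)` only the dyadic intervals near `0` matter. With `ε = log n / n`, the squared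
coefficient at `(j, k)` is at most of order `2 ^ (j (2β - 1)) (k + 1) ^ (-2)` and the variance term
of order `ε 2 ^ (j β)`. Bounding their minimum by the geometric mean with weights `1 - 2s` and `2s`
(`scaled_min_le`) produces `ε ^ (2s)`, the squared rate, times a factor summable in `k` because `2
(1 - 2s) ≥ 4 / 3`, and decaying in `j` like `2 ^ (-2 δ j)` with `δ > 0`.

Levels are not separated by orthogonality: Cauchy–Schwarz with weights `2 ^ (j δ)` spends half of
this decay and leaves a convergent series. The bias beyond a cutoff level `J` is the distance to the
dyadic averages, of squared size `2 ^ (-J (1 - 2β)) ≤ ε ^ (1 - 2β) ≤ ε ^ (2s)`. Unboundedness of the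
intensity is the blow-up of `x ^ (-β)` at `0`. -/

theorem lintegral_pow_poissonMeasure (r : ℝ≥0) {z : ℝ} (hz : 0 ≤ z) :
    ∫⁻ m, ENNReal.ofReal (z ^ m) ∂poissonMeasure r = ENNReal.ofReal (Real.exp (r * (z - 1))) := by
  have hs : HasSum (fun m : ℕ => Real.exp (-r) * (r : ℝ) ^ m / m.factorial * z ^ m)
      (Real.exp (r * (z - 1))) := by
    have h := (NormedSpace.expSeries_div_hasSum_exp ((r : ℝ) * z)).mul_left (Real.exp (-r))
    rw [← Real.exp_eq_exp_ℝ, ← Real.exp_add] at h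
    have e1 : (fun m : ℕ => Real.exp (-r) * (r : ℝ) ^ m / m.factorial * z ^ m)
        = fun m : ℕ => Real.exp (-r) * ((r * z) ^ m / m.factorial) := by
      ext m; rw [mul_pow]; ring
    have e2 : (r : ℝ) * (z - 1) = -r + r * z := by ring
    rw [e1, e2]
    exact h
  rw [poissonMeasure, lintegral_sum_measure, ← hs.tsum_eq,
    ENNReal.ofReal_tsum_of_nonneg (fun m => by positivity) hs.summable]
  refine tsum_congr fun m => ?_
  rw [lintegral_smul_measure, lintegral_dirac, smul_eq_mul, ← ENNReal.ofReal_mul (by positivity)]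

/-- The common form of the Chernoff arguments below: each Poisson expectation is estimated by
choosing `K` and `z` and then using the generating function. -/
theorem lintegral_poissonMeasure_le (r : ℝ≥0) {g : ℕ → ℝ} {K z : ℝ} (hK : 0 ≤ K) (hz : 0 ≤ z)
    (hg : ∀ m, g m ≤ K * z ^ m) :
    ∫⁻ m, ENNReal.ofReal (g m) ∂poissonMeasure r
      ≤ ENNReal.ofReal (K * Real.exp (r * (z - 1))) := by
  calc ∫⁻ m, ENNReal.ofReal (g m) ∂poissonMeasure r
      ≤ ∫⁻ m, ENNReal.ofReal K * ENNReal.ofReal (z ^ m) ∂poissonMeasure r := by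
        refine lintegral_mono fun m => ?_
        rw [← ENNReal.ofReal_mul hK]
        exact ENNReal.ofReal_le_ofReal (hg m)
    _ = _ := by
        rw [lintegral_const_mul _ .of_discrete, lintegral_pow_poissonMeasure r hz,
          ENNReal.ofReal_mul hK]

theorem pow_le_factorial_mul_exp (n : ℕ) {y : ℝ} (hy : 0 ≤ y) :
    y ^ n ≤ n.factorial * Real.exp y := by
  have h := Real.pow_div_factorial_le_exp y hy n
  rwa [div_le_iff₀ (by positivity), mul_comm] at h

theorem lintegral_pow_four_poissonMeasure_le (r : ℝ≥0) :
    ∫⁻ m : ℕ, ENNReal.ofReal ((m : ℝ) ^ 4) ∂poissonMeasure r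
      ≤ ENNReal.ofReal (200 * ((r : ℝ) + 1) ^ 4) := by
  have hr : (0 : ℝ) < (r : ℝ) + 1 := by positivity
  -- This tilt keeps both `t` and `r * t` at most `1`, so `r (exp t - 1) ≤ 2` and the exponential
  -- factor is at most `8`; `24 * 8 ≤ 200`.
  set t : ℝ := 1 / ((r : ℝ) + 1) with ht
  have ht0 : 0 < t := by positivity
  have ht1 : t ≤ 1 := by
    rw [ht, div_le_one hr]; linarith [r.coe_nonneg]
  have hrt : (r : ℝ) * t ≤ 1 := by
    rw [ht, mul_one_div, div_le_one hr]; linarith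
  refine (lintegral_poissonMeasure_le r (K := 24 * ((r : ℝ) + 1) ^ 4) (z := Real.exp t)
    (by positivity) (by positivity) fun m => ?_).trans (ENNReal.ofReal_le_ofReal ?_)
  · have h := pow_le_factorial_mul_exp 4 (y := t * m) (by positivity)
    have h2 : (m : ℝ) ^ 4 = ((r : ℝ) + 1) ^ 4 * (t * m) ^ 4 := by
      rw [ht]; field_simp
    rw [h2, ← Real.exp_nat_mul, mul_comm (m : ℝ) t]
    have h3 : ((4 : ℕ).factorial : ℝ) = 24 := by norm_num [Nat.factorial]
    rw [h3] at h
    nlinarith [pow_pos hr 4]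
  · have h1 := Real.abs_exp_sub_one_sub_id_le (x := t) (by rw [abs_of_pos ht0]; exact ht1)
    have h2 : Real.exp t - 1 ≤ 2 * t := by
      have := (abs_le.1 h1).2
      nlinarith
    have h3 : (r : ℝ) * (Real.exp t - 1) ≤ 1 + 1 := by
      nlinarith [r.coe_nonneg]
    have h4 : Real.exp ((r : ℝ) * (Real.exp t - 1)) ≤ 8 := by
      refine (Real.exp_le_exp.2 h3).trans ?_
      rw [Real.exp_add]
      nlinarith [Real.exp_one_lt_d9, Real.exp_pos 1]
    nlinarith [pow_pos hr 4]

/-- A mean of size at most `1 / t` makes each extra point cost a factor `1 / t`: for `m ≥ d` one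
inserts `t ^ m / t ^ d ≥ 1` and uses `m ^ 2 ≤ 2 exp m`, so that `z = e t` and the exponent is at
most `3`. -/
theorem lintegral_sq_large_poissonMeasure_le (r : ℝ≥0) (d : ℕ) {t : ℝ} (ht : 1 ≤ t)
    (hrt : r * t ≤ 1) :
    ∫⁻ m : ℕ, ENNReal.ofReal (if d ≤ m then (m : ℝ) ^ 2 else 0) ∂poissonMeasure r
      ≤ ENNReal.ofReal (50 / t ^ d) := by
  have ht0 : 0 < t := by linarith
  refine (lintegral_poissonMeasure_le r (K := 2 / t ^ d) (z := Real.exp 1 * t)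
    (by positivity) (by positivity) fun m => ?_).trans (ENNReal.ofReal_le_ofReal ?_)
  · split_ifs with h
    · have h1 := pow_le_factorial_mul_exp 2 (y := m) (by positivity)
      have h3 : ((2 : ℕ).factorial : ℝ) = 2 := by norm_num [Nat.factorial]
      rw [h3] at h1
      have h2 : t ^ d ≤ t ^ m := pow_le_pow_right₀ ht h
      rw [mul_pow, ← Real.exp_nat_mul, mul_one]
      have h4 : 1 ≤ t ^ m / t ^ d := by rwa [one_le_div (by positivity)]
      calc (m : ℝ) ^ 2 ≤ 2 * Real.exp m * 1 := by linarith
        _ ≤ 2 * Real.exp m * (t ^ m / t ^ d) := by gcongr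
        _ = _ := by ring
    · positivity
  · have h3 : (r : ℝ) * (Real.exp 1 * t - 1) ≤ 1 + 1 + 1 := by
      nlinarith [r.coe_nonneg, Real.exp_one_lt_d9, Real.exp_pos 1]
    have h4 : Real.exp ((r : ℝ) * (Real.exp 1 * t - 1)) ≤ 25 := by
      refine (Real.exp_le_exp.2 h3).trans ?_
      rw [Real.exp_add, Real.exp_add]
      have h5 : Real.exp 1 * Real.exp 1 ≤ 8 := by
        nlinarith [Real.exp_one_lt_d9, Real.exp_pos 1]
      nlinarith [Real.exp_one_lt_d9, Real.exp_pos 1]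
    calc 2 / t ^ d * Real.exp ((r : ℝ) * (Real.exp 1 * t - 1)) ≤ 2 / t ^ d * 25 := by gcongr
      _ = _ := by ring

open Classical in
/-- The indicator of a deviation of the count `m` from its mean `r` by at least
`√(x (r + x)) / 4`. -/
noncomputable def deviates (x r : ℝ) (m : ℕ) : ℝ :=
  if Real.sqrt (x * (r + x)) / 4 ≤ |(m : ℝ) - r| then 1 else 0

theorem deviates_nonneg (x r : ℝ) (m : ℕ) : 0 ≤ deviates x r m := by
  unfold deviates; split_ifs <;> norm_num

theorem lintegral_deviates_le (r : ℝ≥0) {x : ℝ} (hx : 0 < x) :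
    ∫⁻ m, ENNReal.ofReal (deviates x r m) ∂poissonMeasure r
      ≤ ENNReal.ofReal (2 * Real.exp (-x / 64)) := by
  have hr := r.coe_nonneg
  set w := Real.sqrt (x * (r + x)) with hw
  have hw2 : w ^ 2 = x * (r + x) := Real.sq_sqrt (by positivity)
  have hw0 : 0 < w := Real.sqrt_pos.2 (by positivity)
  -- The tilt of the two-sided Chernoff bound. The quadratic term `r t ^ 2` is at most `x / 64` and
  -- the deviation contributes `-t w / 4 = -x / 32`, which leaves `-x / 64`.
  set t : ℝ := x / (8 * w) with ht
  have ht0 : 0 < t := by positivity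
  have hxw : x ≤ w := Real.le_sqrt_of_sq_le (by nlinarith)
  have ht1 : t ≤ 1 := by
    rw [ht, div_le_one (by positivity)]; linarith
  have htw : t * w = x / 8 := by rw [ht]; field_simp
  have hrt : (r : ℝ) * t ^ 2 ≤ x / 64 := by
    have h64 : t ^ 2 * (64 * w ^ 2) = x ^ 2 := by rw [ht]; field_simp; norm_num
    rw [hw2] at h64
    have h1 : t ^ 2 * (64 * (r + x)) = x := by
      have : x * (t ^ 2 * (64 * (r + x))) = x * x := by linarith
      exact mul_left_cancel₀ hx.ne' this
    nlinarith [sq_nonneg t]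
  have key : ∀ y : ℝ, |y| = t → Real.exp (r * (Real.exp y - 1)) * Real.exp (-(y * r) - t * w / 4)
      ≤ Real.exp (-x / 64) := by
    intro y hy
    have h1 := (abs_le.1 (Real.abs_exp_sub_one_sub_id_le (x := y) (by rw [hy]; exact ht1))).2
    have hy2 : y ^ 2 = t ^ 2 := by rw [← sq_abs, hy]
    rw [← Real.exp_add]
    refine Real.exp_le_exp.2 ?_
    have h3 : (r : ℝ) * (Real.exp y - 1 - y) ≤ r * t ^ 2 := by
      rw [← hy2]; gcongr
    nlinarith
  calc ∫⁻ m, ENNReal.ofReal (deviates x r m) ∂poissonMeasure r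
      ≤ ∫⁻ m, (ENNReal.ofReal (Real.exp (-(t * r) - t * w / 4) * Real.exp t ^ m)
          + ENNReal.ofReal (Real.exp (-(-t * r) - t * w / 4) * Real.exp (-t) ^ m))
            ∂poissonMeasure r := by
        refine lintegral_mono fun m => ?_
        rw [← ENNReal.ofReal_add (by positivity) (by positivity)]
        refine ENNReal.ofReal_le_ofReal ?_
        unfold deviates
        split_ifs with h
        · rw [← hw] at h
          rw [← Real.exp_nat_mul, ← Real.exp_nat_mul, ← Real.exp_add, ← Real.exp_add]
          rcases le_abs.1 h with h | h
          · have : 1 ≤ Real.exp (-(t * r) - t * w / 4 + m * t) :=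
              Real.one_le_exp (by nlinarith)
            linarith [Real.exp_pos (-(-t * (r : ℝ)) - t * w / 4 + m * -t)]
          · have : 1 ≤ Real.exp (-(-t * r) - t * w / 4 + m * -t) :=
              Real.one_le_exp (by nlinarith)
            linarith [Real.exp_pos (-(t * (r : ℝ)) - t * w / 4 + m * t)]
        · positivity
    _ ≤ ENNReal.ofReal (Real.exp (-x / 64)) + ENNReal.ofReal (Real.exp (-x / 64)) := by
        rw [lintegral_add_left .of_discrete]
        gcongr
        · refine (lintegral_poissonMeasure_le r (by positivity) (Real.exp_pos t).le
            fun m => le_rfl).trans (ENNReal.ofReal_le_ofReal ?_)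
          rw [mul_comm]
          exact key t (abs_of_pos ht0)
        · refine (lintegral_poissonMeasure_le r (by positivity) (Real.exp_pos (-t)).le
            fun m => le_rfl).trans (ENNReal.ofReal_le_ofReal ?_)
          rw [mul_comm]
          exact key (-t) (by rw [abs_neg, abs_of_pos ht0])
    _ = _ := by
        rw [← ENNReal.ofReal_add (by positivity) (by positivity)]
        ring_nf

/-! ### Thresholding a difference of two counts -/

/-- The threshold for a difference of two counts whose sum is `M`, as a function of
`x = γ log n`. -/
noncomputable def countThreshold (x M : ℝ) : ℝ :=
  Real.sqrt (2 * x * (M + Real.sqrt (2 * x * M) + 3 * x)) + x / 3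

open Classical in
/-- The thresholded difference of two counts. -/
noncomputable def keptDiff (x a b : ℝ) : ℝ :=
  if countThreshold x (a + b) ≤ |a - b| then a - b else 0

theorem le_sq_countThreshold {x M : ℝ} (hx : 0 < x) (hM : 0 ≤ M) :
    2 * x * (M + 3 * x) ≤ countThreshold x M ^ 2 := by
  have h0 := Real.sqrt_nonneg (2 * x * M)
  have h1 : 0 ≤ 2 * x * (M + Real.sqrt (2 * x * M) + 3 * x) := by positivity
  have h2 := Real.sq_sqrt h1
  have h3 := Real.sqrt_nonneg (2 * x * (M + Real.sqrt (2 * x * M) + 3 * x))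
  unfold countThreshold
  nlinarith [mul_nonneg h3 hx.le, mul_nonneg hx.le h0]

theorem countThreshold_pos {x : ℝ} (M : ℝ) (hx : 0 < x) : 0 < countThreshold x M := by
  unfold countThreshold; positivity

/-- From `(u + v) ^ 2 ≤ 2 u ^ 2 + 2 v ^ 2` and `√(2 x M) ≤ x + M / 2`; the coefficient of `x ^ 2` is
`16 + 2 / 9`, rounded up. -/
theorem sq_countThreshold_le {x M : ℝ} (hx : 0 < x) (hM : 0 ≤ M) :
    countThreshold x M ^ 2 ≤ 6 * x * M + 17 * x ^ 2 := by
  have h0 := Real.sqrt_nonneg (2 * x * M)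
  have h1 : 0 ≤ 2 * x * (M + Real.sqrt (2 * x * M) + 3 * x) := by positivity
  have h2 := Real.sq_sqrt h1
  have h3 : Real.sqrt (2 * x * M) ≤ x + M / 2 := by
    refine Real.sqrt_le_iff.2 ⟨by positivity, ?_⟩
    nlinarith [sq_nonneg (x - M / 2)]
  unfold countThreshold
  nlinarith [sq_nonneg (Real.sqrt (2 * x * (M + Real.sqrt (2 * x * M) + 3 * x)) - x / 3),
    mul_le_mul_of_nonneg_left h3 hx.le]

theorem abs_keptDiff_le (x a b : ℝ) : |keptDiff x a b| ≤ |a - b| := by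
  unfold keptDiff
  split_ifs
  · exact le_rfl
  · simp

/-- The deterministic half of the oracle inequality. When both counts are near their means, the
error of `a - b` is at most half the threshold `L`. A kept difference then has `|p - q| ≥ L / 2`, at
least the error, and a discarded one has `|p - q| ≤ 3 L / 2`; both cases are bounded by `(p - q) ^
2` and by `9 / 4 * L ^ 2`. -/
theorem sq_keptDiff_sub_le_of_near {x a b p q : ℝ} (hx : 0 < x) (ha : 0 ≤ a) (hb : 0 ≤ b)
    (hp : 0 ≤ p) (hq : 0 ≤ q) (hap : |a - p| ≤ Real.sqrt (x * (p + x)) / 4)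
    (hbq : |b - q| ≤ Real.sqrt (x * (q + x)) / 4) :
    (keptDiff x a b - (p - q)) ^ 2 ≤ min ((p - q) ^ 2) (90 * (x * (p + q))) := by
  -- The deviation is measured with the mean, the threshold with the observed counts; this converts
  -- one into the other. The first bound is tuned to `2 x (M + 3 x) ≤ L ^ 2`.
  have near : ∀ {a p : ℝ}, 0 ≤ a → 0 ≤ p → |a - p| ≤ Real.sqrt (x * (p + x)) / 4 →
      8 * (a - p) ^ 2 ≤ x * (2 * a + 3 * x) ∧ a ≤ 5 / 4 * p + x / 4 := by
    intro a p ha hp h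
    have h0 : 0 ≤ x * (p + x) := by positivity
    have h1 : 16 * (a - p) ^ 2 ≤ x * (p + x) := by
      have h2 : |a - p| ^ 2 ≤ (Real.sqrt (x * (p + x)) / 4) ^ 2 := by gcongr
      rw [sq_abs, div_pow, Real.sq_sqrt h0] at h2
      linarith
    refine ⟨?_, ?_⟩
    · nlinarith [sq_nonneg (x / 2 + (a - p)), mul_nonneg hx.le ha, sq_nonneg x]
    · have h3 : Real.sqrt (x * (p + x)) ≤ p + x :=
        Real.sqrt_le_iff.2 ⟨by positivity, by nlinarith⟩
      linarith [(abs_le.1 h).2]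
  obtain ⟨ha1, ha2⟩ := near ha hp hap
  obtain ⟨hb1, hb2⟩ := near hb hq hbq
  have hM : 0 ≤ a + b := by positivity
  have hL1 := le_sq_countThreshold hx hM
  have hL2 := sq_countThreshold_le hx hM
  have hL0 := countThreshold_pos (a + b) hx
  set L := countThreshold x (a + b) with hL
  have hL3 : L ^ 2 ≤ 20 * (x * (p + q + x)) := by nlinarith
  have hD : |(a - b) - (p - q)| ≤ L / 2 := by
    refine abs_le_of_sq_le_sq ?_ (by positivity)
    nlinarith [sq_nonneg ((a - p) + (b - q))]
  have main : (keptDiff x a b - (p - q)) ^ 2 ≤ (p - q) ^ 2 ∧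
      (keptDiff x a b - (p - q)) ^ 2 ≤ 9 / 4 * L ^ 2 := by
    unfold keptDiff
    rw [← hL]
    split_ifs with h
    · have h1 : L / 2 ≤ |p - q| := by
        have := abs_sub_abs_le_abs_sub (a - b) (p - q)
        linarith
      refine ⟨sq_le_sq.2 (hD.trans h1), ?_⟩
      have : (a - b - (p - q)) ^ 2 ≤ (L / 2) ^ 2 :=
        sq_le_sq.2 (hD.trans (le_abs_self _))
      nlinarith
    · have h1 : |p - q| ≤ 3 / 2 * L := by
        have := abs_sub_abs_le_abs_sub (p - q) (a - b)
        rw [abs_sub_comm (p - q)] at this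
        linarith [not_le.1 h]
      have h2 : (p - q) ^ 2 ≤ (3 / 2 * L) ^ 2 := sq_le_sq.2 (h1.trans (le_abs_self _))
      constructor <;> nlinarith
  refine le_min main.1 ?_
  -- The bound on `L ^ 2` contains `x ^ 2`. If `x ≤ p + q` it is absorbed, giving `9 / 4 * 20 * 2 =
  -- 90`; otherwise `(p - q) ^ 2 ≤ (p + q) ^ 2 ≤ x (p + q)` directly.
  rcases le_total x (p + q) with h | h
  · nlinarith [main.2, mul_le_mul_of_nonneg_left h hx.le]
  · have h1 : (p - q) ^ 2 ≤ x * (p + q) := by nlinarith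
    nlinarith [main.1, mul_nonneg hx.le (add_nonneg hp hq)]

/-- The right side is a constant plus a function of `a` plus a function of `b`, so only the marginal
laws matter and independence of the counts is never needed. On the bad event the cross terms, such
as `a ^ 2` when only `b` deviates, are decoupled by `2 y ^ 2 ≤ η y ^ 4 + 1 / η`. -/
theorem sq_keptDiff_sub_le {x p q : ℝ} (hx : 0 < x) (hp : 0 ≤ p) (hq : 0 ≤ q) {η : ℝ}
    (hη : 0 < η) (a b : ℕ) :
    (keptDiff x a b - (p - q)) ^ 2 ≤ min ((p - q) ^ 2) (90 * (x * (p + q)))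
      + (η * (a : ℝ) ^ 4 + (2 / η + 2 * (p ^ 2 + q ^ 2)) * deviates x p a)
      + (η * (b : ℝ) ^ 4 + (2 / η + 2 * (p ^ 2 + q ^ 2)) * deviates x q b) := by
  have hmin : 0 ≤ min ((p - q) ^ 2) (90 * (x * (p + q))) := le_min (by positivity) (by positivity)
  by_cases h : |(a : ℝ) - p| ≤ Real.sqrt (x * (p + x)) / 4 ∧
      |(b : ℝ) - q| ≤ Real.sqrt (x * (q + x)) / 4
  · have h1 := sq_keptDiff_sub_le_of_near hx a.cast_nonneg b.cast_nonneg hp hq h.1 h.2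
    have h2 := deviates_nonneg x p a
    have h3 := deviates_nonneg x q b
    have h4 : 0 ≤ η * (a : ℝ) ^ 4 + (2 / η + 2 * (p ^ 2 + q ^ 2)) * deviates x p a := by positivity
    have h5 : 0 ≤ η * (b : ℝ) ^ 4 + (2 / η + 2 * (p ^ 2 + q ^ 2)) * deviates x q b := by positivity
    linarith
  · have hdev : 1 ≤ deviates x p a + deviates x q b := by
      rw [not_and_or, not_le, not_le] at h
      rcases h with h | h
      · have : deviates x p a = 1 := if_pos h.le
        linarith [deviates_nonneg x q b]
      · have : deviates x q b = 1 := if_pos h.le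
        linarith [deviates_nonneg x p a]
    have ha : (0 : ℝ) ≤ a := a.cast_nonneg
    have hb : (0 : ℝ) ≤ b := b.cast_nonneg
    have hk : keptDiff x a b ^ 2 ≤ (a : ℝ) ^ 2 + (b : ℝ) ^ 2 := by
      have := sq_le_sq.2 (abs_keptDiff_le x a b)
      nlinarith [mul_nonneg ha hb]
    have h1 : (keptDiff x a b - (p - q)) ^ 2
        ≤ 2 * ((a : ℝ) ^ 2 + (b : ℝ) ^ 2) + 2 * (p ^ 2 + q ^ 2) := by
      nlinarith [sq_nonneg (keptDiff x a b + (p - q)), mul_nonneg hp hq]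
    have amgm : ∀ y : ℝ, 2 * y ^ 2 ≤ η * y ^ 4 + 1 / η := by
      intro y
      have : η * y ^ 4 + 1 / η - 2 * y ^ 2 = (η * y ^ 2 - 1) ^ 2 / η := by
        field_simp; ring
      have : 0 ≤ (η * y ^ 2 - 1) ^ 2 / η := by positivity
      linarith
    have h2 := amgm a
    have h3 := amgm b
    have h4 : 0 ≤ 2 / η + 2 * (p ^ 2 + q ^ 2) := by positivity
    have h5 : (1 : ℝ) / η + 1 / η = 2 / η := by ring
    nlinarith [mul_le_mul_of_nonneg_left hdev h4]

/-- The threshold is at least `x` whatever the counts are, so a kept difference forces the larger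
count to be at least `d`, and that count dominates the difference. -/
theorem sq_keptDiff_le_large {x : ℝ} {d : ℕ} (hd : (d : ℝ) ≤ x) (hx : 0 < x) (a b : ℕ) :
    keptDiff x a b ^ 2 ≤ (if d ≤ a then (a : ℝ) ^ 2 else 0) + (if d ≤ b then (b : ℝ) ^ 2 else 0) := by
  have h0 : 0 ≤ (if d ≤ a then (a : ℝ) ^ 2 else 0) := by positivity
  have h0' : 0 ≤ (if d ≤ b then (b : ℝ) ^ 2 else 0) := by positivity
  unfold keptDiff
  by_cases h : countThreshold x (a + b) ≤ |(a : ℝ) - b|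
  · rw [if_pos h]
    have ha : (0 : ℝ) ≤ a := a.cast_nonneg
    have hb : (0 : ℝ) ≤ b := b.cast_nonneg
    have h1 := le_sq_countThreshold hx (add_nonneg ha hb)
    have h2 : x ≤ countThreshold x (a + b) := by
      refine le_of_sq_le_sq ?_ (countThreshold_pos _ hx).le
      nlinarith [mul_nonneg hx.le (add_nonneg ha hb)]
    rcases le_total (a : ℝ) b with hab | hab
    · rw [abs_sub_comm, abs_of_nonneg (by linarith)] at h
      have : d ≤ b := by exact_mod_cast (by linarith : (d : ℝ) ≤ b)
      rw [if_pos this]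
      nlinarith [mul_nonneg ha hb]
    · rw [abs_of_nonneg (by linarith)] at h
      have : d ≤ a := by exact_mod_cast (by linarith : (d : ℝ) ≤ a)
      rw [if_pos this]
      nlinarith [mul_nonneg ha hb]
  · rw [if_neg h]
    simpa using add_nonneg h0 h0'

/-! ### Mean squared error of a thresholded difference of Poisson counts. -/

section Risk

variable {Ω : Type*} [MeasurableSpace Ω] {P : Measure Ω} {A B : Ω → ℕ} {p q : ℝ≥0}

theorem lintegral_comp_law (hA : Measurable A) (hAp : P.map A = poissonMeasure p) (g : ℕ → ℝ≥0∞) :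
    ∫⁻ ω, g (A ω) ∂P = ∫⁻ m, g m ∂poissonMeasure p := by
  rw [← hAp, lintegral_map .of_discrete hA]

/-- The oracle inequality for a thresholded difference of two Poisson variables. -/
theorem lintegral_sq_keptDiff_sub_le [IsProbabilityMeasure P]
    (hA : Measurable A) (hB : Measurable B)
    (hAp : P.map A = poissonMeasure p) (hBq : P.map B = poissonMeasure q) {x : ℝ} (hx : 0 < x) :
    ∫⁻ ω, ENNReal.ofReal ((keptDiff x (A ω) (B ω) - (p - q)) ^ 2) ∂P
      ≤ ENNReal.ofReal (min (((p : ℝ) - q) ^ 2) (90 * (x * (p + q)))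
          + 500 * Real.exp (-x / 128) * ((p : ℝ) + q + 1) ^ 4) := by
  -- The square root of the exponential in the deviation bound: it balances `η` times the fourth
  -- moments against `exp (-x / 64) / η`.
  set η := Real.exp (-x / 128) with hη
  have hη0 : 0 < η := Real.exp_pos _
  have hη2 : Real.exp (-x / 64) = η ^ 2 := by
    rw [hη, ← Real.exp_nat_mul]; congr 1; push_cast; ring
  have hp := p.coe_nonneg
  have hq := q.coe_nonneg
  set c : ℝ := 2 / η + 2 * ((p : ℝ) ^ 2 + (q : ℝ) ^ 2) with hc
  have hc0 : 0 ≤ c := by positivity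
  have part : ∀ r : ℝ≥0, ∫⁻ m : ℕ, ENNReal.ofReal (η * (m : ℝ) ^ 4 + c * deviates x r m)
      ∂poissonMeasure r ≤ ENNReal.ofReal (η * (200 * ((r : ℝ) + 1) ^ 4) + c * (2 * η ^ 2)) := by
    intro r
    have e : ∀ m : ℕ, ENNReal.ofReal (η * (m : ℝ) ^ 4 + c * deviates x r m)
        = ENNReal.ofReal η * ENNReal.ofReal ((m : ℝ) ^ 4)
          + ENNReal.ofReal c * ENNReal.ofReal (deviates x r m) := by
      intro m
      rw [ENNReal.ofReal_add (by positivity) (mul_nonneg hc0 (deviates_nonneg _ _ _)),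
        ENNReal.ofReal_mul hη0.le, ENNReal.ofReal_mul hc0]
    simp_rw [e]
    rw [lintegral_add_left .of_discrete, lintegral_const_mul _ .of_discrete,
      lintegral_const_mul _ .of_discrete,
      ENNReal.ofReal_add (p := η * (200 * ((r : ℝ) + 1) ^ 4)) (by positivity) (by positivity),
      ENNReal.ofReal_mul hη0.le, ENNReal.ofReal_mul hc0, ← hη2]
    gcongr
    · exact lintegral_pow_four_poissonMeasure_le r
    · exact lintegral_deviates_le r hx
  have hmin : 0 ≤ min (((p : ℝ) - q) ^ 2) (90 * (x * (p + q))) :=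
    le_min (by positivity) (by positivity)
  calc ∫⁻ ω, ENNReal.ofReal ((keptDiff x (A ω) (B ω) - (p - q)) ^ 2) ∂P
      ≤ ∫⁻ ω, (ENNReal.ofReal (min (((p : ℝ) - q) ^ 2) (90 * (x * (p + q))))
          + ENNReal.ofReal (η * (A ω : ℝ) ^ 4 + c * deviates x p (A ω))
          + ENNReal.ofReal (η * (B ω : ℝ) ^ 4 + c * deviates x q (B ω))) ∂P := by
        refine lintegral_mono fun ω => ?_
        have h1 : 0 ≤ η * (A ω : ℝ) ^ 4 + c * deviates x p (A ω) :=
          add_nonneg (by positivity) (mul_nonneg hc0 (deviates_nonneg _ _ _))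
        have h2 : 0 ≤ η * (B ω : ℝ) ^ 4 + c * deviates x q (B ω) :=
          add_nonneg (by positivity) (mul_nonneg hc0 (deviates_nonneg _ _ _))
        rw [← ENNReal.ofReal_add hmin h1, ← ENNReal.ofReal_add (by positivity) h2]
        exact ENNReal.ofReal_le_ofReal (sq_keptDiff_sub_le hx hp hq hη0 _ _)
    _ = ENNReal.ofReal (min (((p : ℝ) - q) ^ 2) (90 * (x * (p + q))))
          + ∫⁻ m : ℕ, ENNReal.ofReal (η * (m : ℝ) ^ 4 + c * deviates x p m) ∂poissonMeasure p
          + ∫⁻ m : ℕ, ENNReal.ofReal (η * (m : ℝ) ^ 4 + c * deviates x q m) ∂poissonMeasure q := by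
        have mA : Measurable fun ω => ENNReal.ofReal (η * (A ω : ℝ) ^ 4 + c * deviates x p (A ω)) :=
          (Measurable.of_discrete (f := fun m : ℕ =>
            ENNReal.ofReal (η * (m : ℝ) ^ 4 + c * deviates x p m))).comp hA
        rw [lintegral_add_left (mA.const_add _), lintegral_add_left measurable_const,
          lintegral_const, measure_univ, mul_one,
          lintegral_comp_law hA hAp fun m : ℕ =>
            ENNReal.ofReal (η * (m : ℝ) ^ 4 + c * deviates x p m),
          lintegral_comp_law hB hBq fun m : ℕ =>
            ENNReal.ofReal (η * (m : ℝ) ^ 4 + c * deviates x q m)]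
    _ ≤ _ := by
        refine (add_le_add (add_le_add le_rfl (part p)) (part q)).trans ?_
        rw [← ENNReal.ofReal_add hmin (by positivity),
          ← ENNReal.ofReal_add (by positivity) (by positivity)]
        refine ENNReal.ofReal_le_ofReal ?_
        have hη1 : η ≤ 1 := Real.exp_le_one_iff.2 (by linarith)
        have e1 : c * (2 * η ^ 2) = η * (4 + 4 * η * ((p : ℝ) ^ 2 + (q : ℝ) ^ 2)) := by
          rw [hc]; field_simp; ring
        have hw : (1 : ℝ) ≤ p + q + 1 := by linarith
        have h1 : ((p : ℝ) + 1) ^ 4 ≤ (p + q + 1) ^ 4 := by gcongr; linarith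
        have h2 : ((q : ℝ) + 1) ^ 4 ≤ (p + q + 1) ^ 4 := by gcongr; linarith
        have h3 : (1 : ℝ) ≤ (p + q + 1) ^ 4 := one_le_pow₀ hw
        have h4 : (p : ℝ) ^ 2 + (q : ℝ) ^ 2 ≤ (p + q + 1) ^ 4 := by
          have : (p : ℝ) ^ 2 + (q : ℝ) ^ 2 ≤ (p + q + 1) ^ 2 := by nlinarith [mul_nonneg hp hq]
          exact this.trans (pow_le_pow_right₀ hw (by norm_num))
        have h5 : η * ((p : ℝ) ^ 2 + (q : ℝ) ^ 2) ≤ (p + q + 1) ^ 4 := by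
          have : 0 ≤ (p : ℝ) ^ 2 + (q : ℝ) ^ 2 := by positivity
          nlinarith
        have h6 : 200 * ((p : ℝ) + 1) ^ 4 + 200 * ((q : ℝ) + 1) ^ 4
            + 2 * (4 + 4 * η * ((p : ℝ) ^ 2 + (q : ℝ) ^ 2)) ≤ 500 * (p + q + 1) ^ 4 := by
          linarith
        rw [e1]
        nlinarith [mul_le_mul_of_nonneg_left h6 hη0.le]

theorem lintegral_sq_keptDiff_le (hA : Measurable A) (hB : Measurable B)
    (hAp : P.map A = poissonMeasure p) (hBq : P.map B = poissonMeasure q) {x : ℝ} (hx : 0 < x)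
    {d : ℕ} (hd : (d : ℝ) ≤ x) {t : ℝ} (ht : 1 ≤ t) (hpt : p * t ≤ 1) (hqt : q * t ≤ 1) :
    ∫⁻ ω, ENNReal.ofReal (keptDiff x (A ω) (B ω) ^ 2) ∂P ≤ ENNReal.ofReal (100 / t ^ d) := by
  calc ∫⁻ ω, ENNReal.ofReal (keptDiff x (A ω) (B ω) ^ 2) ∂P
      ≤ ∫⁻ ω, (ENNReal.ofReal (if d ≤ A ω then (A ω : ℝ) ^ 2 else 0)
          + ENNReal.ofReal (if d ≤ B ω then (B ω : ℝ) ^ 2 else 0)) ∂P := by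
        refine lintegral_mono fun ω => ?_
        rw [← ENNReal.ofReal_add (by positivity) (by positivity)]
        exact ENNReal.ofReal_le_ofReal (sq_keptDiff_le_large hd hx _ _)
    _ ≤ ENNReal.ofReal (50 / t ^ d) + ENNReal.ofReal (50 / t ^ d) := by
        have mA : Measurable fun ω => ENNReal.ofReal (if d ≤ A ω then (A ω : ℝ) ^ 2 else 0) :=
          (Measurable.of_discrete (f := fun m : ℕ =>
            ENNReal.ofReal (if d ≤ m then (m : ℝ) ^ 2 else 0))).comp hA
        rw [lintegral_add_left mA,
          lintegral_comp_law hA hAp fun m : ℕ => ENNReal.ofReal (if d ≤ m then (m : ℝ) ^ 2 else 0),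
          lintegral_comp_law hB hBq fun m : ℕ => ENNReal.ofReal (if d ≤ m then (m : ℝ) ^ 2 else 0)]
        exact add_le_add (lintegral_sq_large_poissonMeasure_le p d ht hpt)
          (lintegral_sq_large_poissonMeasure_le q d ht hqt)
    _ = _ := by
        have : 0 ≤ 50 / t ^ d := by positivity
        rw [← ENNReal.ofReal_add this this]
        ring_nf

end Risk

/-! ### Dyadic intervals -/

/-- The dyadic interval `[k / 2 ^ j, (k + 1) / 2 ^ j)`. -/
def dyadic (j k : ℕ) : Set ℝ := Ico ((k : ℝ) / 2 ^ j) (((k : ℝ) + 1) / 2 ^ j)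

theorem measurableSet_dyadic (j k : ℕ) : MeasurableSet (dyadic j k) := measurableSet_Ico

theorem volume_dyadic (j k : ℕ) : volume (dyadic j k) = ENNReal.ofReal (1 / 2 ^ j) := by
  rw [dyadic, Real.volume_Ico]; congr 1; ring

theorem dyadic_left_lt_right (j k : ℕ) : (k : ℝ) / 2 ^ j < ((k : ℝ) + 1) / 2 ^ j := by
  gcongr; linarith

theorem dyadic_subset_unit {j k : ℕ} (hk : k < 2 ^ j) : dyadic j k ⊆ Ico 0 1 := by
  refine Ico_subset_Ico (by positivity) ?_
  rw [div_le_one (by positivity)]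
  exact_mod_cast hk

theorem dyadic_union (j k : ℕ) :
    dyadic (j + 1) (2 * k) ∪ dyadic (j + 1) (2 * k + 1) = dyadic j k := by
  have e1 : ((2 * k : ℕ) : ℝ) / 2 ^ (j + 1) = k / 2 ^ j := by
    push_cast; rw [pow_succ]; field_simp
  have e2 : (((2 * k + 1 : ℕ) : ℝ) + 1) / 2 ^ (j + 1) = (k + 1) / 2 ^ j := by
    push_cast; rw [pow_succ]; field_simp; ring
  have e3 : ((2 * k + 1 : ℕ) : ℝ) / 2 ^ (j + 1) = (((2 * k : ℕ) : ℝ) + 1) / 2 ^ (j + 1) := by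
    push_cast; rfl
  have h1 := (dyadic_left_lt_right (j + 1) (2 * k)).le
  have h2 := (dyadic_left_lt_right (j + 1) (2 * k + 1)).le
  unfold dyadic
  rw [e3] at h2 ⊢
  rw [Ico_union_Ico_eq_Ico h1 h2, e1, e2]

theorem disjoint_dyadic {j k l : ℕ} (h : k ≠ l) : Disjoint (dyadic j k) (dyadic j l) := by
  rw [Set.disjoint_left]
  rintro x ⟨h1, h2⟩ ⟨h3, h4⟩
  have hj : (0 : ℝ) < 2 ^ j := by positivity
  have h5 := (div_lt_div_iff_of_pos_right hj).1 (h1.trans_lt h4)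
  have h6 := (div_lt_div_iff_of_pos_right hj).1 (h3.trans_lt h2)
  have h7 : k < l + 1 := by exact_mod_cast h5
  have h8 : l < k + 1 := by exact_mod_cast h6
  omega

theorem exists_mem_dyadic (j : ℕ) {x : ℝ} (h0 : 0 ≤ x) (h1 : x < 1) :
    ∃ k < 2 ^ j, x ∈ dyadic j k := by
  have hj : (0 : ℝ) < 2 ^ j := by positivity
  refine ⟨⌊x * 2 ^ j⌋₊, ?_, ?_, ?_⟩
  · rw [Nat.floor_lt (by positivity)]
    push_cast
    nlinarith
  · rw [div_le_iff₀ hj]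
    exact Nat.floor_le (by positivity)
  · rw [lt_div_iff₀ hj]
    exact Nat.lt_floor_add_one _

/-- The integral of `f` over a dyadic interval. -/
noncomputable def dyadicMass (f : ℝ → ℝ) (j k : ℕ) : ℝ := ∫ x in dyadic j k, f x

theorem dyadicMass_split {f : ℝ → ℝ} (hf : Integrable f) (j k : ℕ) :
    dyadicMass f j k = dyadicMass f (j + 1) (2 * k) + dyadicMass f (j + 1) (2 * k + 1) := by
  unfold dyadicMass
  rw [← dyadic_union, setIntegral_union (disjoint_dyadic (by omega)) (measurableSet_dyadic _ _)
    hf.integrableOn hf.integrableOn]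

/-! ### The intensity `x ^ (-β)` on the unit interval -/

section Intensity

variable {β : ℝ}

theorem fBeta_nonneg (β x : ℝ) : 0 ≤ fBeta β x := by
  unfold fBeta
  exact indicator_nonneg (fun y hy => Real.rpow_nonneg hy.1 _) x

theorem fBeta_of_mem {x : ℝ} (hx : x ∈ Icc (0 : ℝ) 1) : fBeta β x = x ^ (-β) :=
  indicator_of_mem hx _

theorem fBeta_of_notMem {x : ℝ} (hx : x ∉ Icc (0 : ℝ) 1) : fBeta β x = 0 :=
  indicator_of_notMem hx _

theorem measurable_fBeta (β : ℝ) : Measurable (fBeta β) :=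
  (measurable_id.pow_const (-β)).indicator measurableSet_Icc

theorem sq_fBeta (β x : ℝ) : fBeta β x ^ 2 = fBeta (2 * β) x := by
  by_cases hx : x ∈ Icc (0 : ℝ) 1
  · rw [fBeta_of_mem hx, fBeta_of_mem hx, ← Real.rpow_natCast, ← Real.rpow_mul hx.1]
    congr 1; push_cast; ring
  · rw [fBeta_of_notMem hx, fBeta_of_notMem hx]; norm_num

theorem integrable_fBeta (hβ : β < 1) : Integrable (fBeta β) := by
  unfold fBeta
  rw [integrable_indicator_iff measurableSet_Icc, integrableOn_Icc_iff_integrableOn_Ioc,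
    ← intervalIntegrable_iff_integrableOn_Ioc_of_le zero_le_one]
  exact intervalIntegral.intervalIntegrable_rpow' (by linarith)

theorem memLp_one_fBeta (hβ : β < 1) : MemLp (fBeta β) 1 volume :=
  memLp_one_iff_integrable.2 (integrable_fBeta hβ)

theorem memLp_two_fBeta (hβ : β < 1 / 2) : MemLp (fBeta β) 2 volume := by
  rw [memLp_two_iff_integrable_sq (measurable_fBeta β).aestronglyMeasurable]
  simp_rw [sq_fBeta]
  exact integrable_fBeta (by linarith)

theorem not_memLp_top_fBeta (hβ : 0 < β) : ¬ MemLp (fBeta β) ∞ volume := by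
  intro h
  have h1 : ∀ᵐ x, ‖fBeta β x‖ ≤ (eLpNorm (fBeta β) ∞ volume).toReal := by
    have h3 := ae_le_eLpNormEssSup (f := fBeta β) (μ := volume)
    filter_upwards [h3] with x hx
    rw [← eLpNorm_exponent_top] at hx
    rw [← toReal_enorm]
    exact ENNReal.toReal_mono h.2.ne hx
  set C := (eLpNorm (fBeta β) ∞ volume).toReal
  have h2 := (tendsto_rpow_neg_nhdsGT_zero (neg_lt_zero.2 hβ)).eventually_gt_atTop C
  obtain ⟨δ, hδ, hδ2⟩ := mem_nhdsGT_iff_exists_Ioo_subset.1 h2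
  have hδ0 : (0 : ℝ) < δ := hδ
  have h3 : volume (Ioo (0 : ℝ) (min δ 1)) = 0 := by
    refine measure_mono_null ?_ (ae_iff.1 h1)
    intro x hx hxC
    have hx1 : x ∈ Icc (0 : ℝ) 1 := ⟨hx.1.le, hx.2.le.trans (min_le_right _ _)⟩
    have : C < x ^ (-β) := hδ2 ⟨hx.1, hx.2.trans_le (min_le_left _ _)⟩
    rw [Real.norm_eq_abs, abs_of_nonneg (fBeta_nonneg _ _), fBeta_of_mem hx1] at hxC
    linarith
  rw [Real.volume_Ioo, ENNReal.ofReal_eq_zero] at h3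
  have : 0 < min δ 1 := lt_min hδ0 one_pos
  linarith

/-- Positivity of `x` matters: for `β > 0` the real power takes the value `0` at `0`, and
monotonicity fails there. This is why the interval `k = 0` is treated separately below. -/
theorem fBeta_anti (hβ : 0 ≤ β) {x y : ℝ} (hx : 0 < x) (hxy : x ≤ y) (hy : y ≤ 1) :
    fBeta β y ≤ fBeta β x := by
  rw [fBeta_of_mem ⟨hx.le.trans hxy, hy⟩, fBeta_of_mem ⟨hx.le, hxy.trans hy⟩]
  exact Real.rpow_le_rpow_of_nonpos hx hxy (by linarith)

theorem dyadicMass_fBeta_nonneg (β : ℝ) (j k : ℕ) : 0 ≤ dyadicMass (fBeta β) j k :=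
  setIntegral_nonneg (measurableSet_dyadic _ _) fun x _ => fBeta_nonneg β x

theorem dyadicMass_fBeta_zero (hβ : β < 1) (j : ℕ) :
    dyadicMass (fBeta β) j 0 = ((2 : ℝ) ^ j) ^ (β - 1) / (1 - β) := by
  have hj : (0 : ℝ) < 2 ^ j := by positivity
  have h1 : (1 : ℝ) / 2 ^ j ≤ 1 := by
    rw [div_le_one hj]; exact one_le_pow₀ (by norm_num)
  have h2 : dyadicMass (fBeta β) j 0 = ∫ x in Ico (0 : ℝ) (1 / 2 ^ j), x ^ (-β) := by
    unfold dyadicMass dyadic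
    rw [Nat.cast_zero, zero_div, zero_add]
    exact setIntegral_congr_fun measurableSet_Ico
      fun x hx => fBeta_of_mem ⟨hx.1, hx.2.le.trans h1⟩
  rw [h2, integral_Ico_eq_integral_Ioc, ← intervalIntegral.integral_of_le (by positivity),
    integral_rpow (Or.inl (by linarith)), Real.zero_rpow (by linarith), sub_zero,
    one_div, Real.inv_rpow hj.le, ← Real.rpow_neg hj.le]
  congr 1
  · congr 1; ring
  · ring

theorem volume_real_dyadic (j k : ℕ) : volume.real (dyadic j k) = 1 / 2 ^ j := by
  rw [measureReal_def, volume_dyadic, ENNReal.toReal_ofReal (by positivity)]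

theorem fBeta_le_of_mem_dyadic (hβ : 0 ≤ β) {j k : ℕ} (hk0 : k ≠ 0) (hk : k < 2 ^ j) {x : ℝ}
    (hx : x ∈ dyadic j k) :
    fBeta β ((k + 1) / 2 ^ j) ≤ fBeta β x ∧ fBeta β x ≤ fBeta β (k / 2 ^ j) := by
  have hk1 : (0 : ℝ) < k := by positivity
  have h1 : ((k : ℝ) + 1) / 2 ^ j ≤ 1 := by
    rw [div_le_one (by positivity)]; exact_mod_cast hk
  have h2 : (0 : ℝ) < k / 2 ^ j := by positivity
  exact ⟨fBeta_anti hβ (h2.trans_le hx.1) hx.2.le h1, fBeta_anti hβ h2 hx.1 (hx.2.le.trans h1)⟩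

theorem dyadicMass_fBeta_mem (hβ : 0 ≤ β) (hβ1 : β < 1) {j k : ℕ} (hk0 : k ≠ 0) (hk : k < 2 ^ j) :
    fBeta β ((k + 1) / 2 ^ j) ≤ 2 ^ j * dyadicMass (fBeta β) j k ∧
      2 ^ j * dyadicMass (fBeta β) j k ≤ fBeta β (k / 2 ^ j) := by
  have hj : (0 : ℝ) < 2 ^ j := by positivity
  have hi := (integrable_fBeta hβ1).integrableOn (s := dyadic j k)
  have hc : ∀ c : ℝ, ∫ _ in dyadic j k, c = c / 2 ^ j := by
    intro c
    rw [setIntegral_const, volume_real_dyadic, smul_eq_mul]; ring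
  have hfin : volume (dyadic j k) ≠ ∞ := by rw [volume_dyadic]; exact ENNReal.ofReal_ne_top
  have hci : ∀ c : ℝ, IntegrableOn (fun _ => c) (dyadic j k) := fun c =>
    integrableOn_const hfin
  constructor
  · have h := setIntegral_mono_on (hci (fBeta β ((k + 1) / 2 ^ j))) hi (measurableSet_dyadic j k)
      fun x hx => (fBeta_le_of_mem_dyadic hβ hk0 hk hx).1
    rw [hc, div_le_iff₀ hj] at h
    rw [mul_comm]; exact h
  · have h := setIntegral_mono_on hi (hci (fBeta β (k / 2 ^ j))) (measurableSet_dyadic j k)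
      fun x hx => (fBeta_le_of_mem_dyadic hβ hk0 hk hx).2
    rw [hc, le_div_iff₀ hj] at h
    rw [mul_comm]; exact h

theorem fBeta_div_two_pow {j k : ℕ} (hk : k ≤ 2 ^ j) :
    fBeta β (k / 2 ^ j) = ((2 : ℝ) ^ j) ^ β * (k : ℝ) ^ (-β) := by
  have hj : (0 : ℝ) < 2 ^ j := by positivity
  have h1 : (k : ℝ) / 2 ^ j ≤ 1 := by
    rw [div_le_one hj]; exact_mod_cast hk
  rw [fBeta_of_mem ⟨by positivity, h1⟩, Real.div_rpow k.cast_nonneg hj.le,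
    Real.rpow_neg hj.le β, div_inv_eq_mul, mul_comm]

/-- Factor out `k ^ (-β) ≤ 1`; what remains is `1 - (k / (k + 1)) ^ β`, and a number in `[0, 1]`
does not decrease when raised to a power `β ≤ 1`. -/
theorem rpow_neg_sub_rpow_neg_le (hβ : 0 ≤ β) (hβ1 : β ≤ 1) {k : ℕ} (hk : k ≠ 0) :
    (k : ℝ) ^ (-β) - ((k : ℝ) + 1) ^ (-β) ≤ 1 / (k + 1) := by
  have hk1 : (0 : ℝ) < k := by positivity
  have hk2 : (1 : ℝ) ≤ k := by exact_mod_cast Nat.one_le_iff_ne_zero.2 hk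
  have h1 : ((k : ℝ) + 1) ^ (-β) = (k : ℝ) ^ (-β) * (k / (k + 1)) ^ β := by
    rw [Real.div_rpow hk1.le (by positivity), Real.rpow_neg hk1.le, Real.rpow_neg (by positivity)]
    field_simp
  have h2 : (k : ℝ) / (k + 1) ≤ (k / (k + 1)) ^ β := by
    refine Real.self_le_rpow_of_le_one (by positivity) ?_ hβ1
    rw [div_le_one (by positivity)]; linarith
  have h3 : (k : ℝ) ^ (-β) ≤ 1 := Real.rpow_le_one_of_one_le_of_nonpos hk2 (by linarith)
  have h4 : 0 ≤ (k : ℝ) ^ (-β) := by positivity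
  have h5 : (1 : ℝ) - k / (k + 1) = 1 / (k + 1) := by field_simp; ring
  have h6 : (0 : ℝ) < 1 / (k + 1) := by positivity
  rw [h1, ← h5]
  rw [← h5] at h6
  nlinarith

theorem fBeta_dyadic_variation_le (hβ : 0 ≤ β) (hβ1 : β ≤ 1) {j k : ℕ} (hk0 : k ≠ 0)
    (hk : k < 2 ^ j) :
    fBeta β (k / 2 ^ j) - fBeta β ((k + 1) / 2 ^ j) ≤ ((2 : ℝ) ^ j) ^ β / (k + 1) := by
  have h1 := fBeta_div_two_pow (β := β) hk.le
  have h2 := fBeta_div_two_pow (β := β) (k := k + 1) hk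
  push_cast at h2
  rw [h1, h2, ← mul_sub, div_eq_mul_one_div]
  exact mul_le_mul_of_nonneg_left (rpow_neg_sub_rpow_neg_le hβ hβ1 hk0) (by positivity)

theorem two_pow_rpow_sub_one (β : ℝ) (j : ℕ) :
    ((2 : ℝ) ^ j) ^ (β - 1) = ((2 : ℝ) ^ j) ^ β / 2 ^ j := by
  rw [Real.rpow_sub_one (by positivity)]

theorem dyadicMass_fBeta_zero_le (hβ1 : β ≤ 1 / 2) (j : ℕ) :
    dyadicMass (fBeta β) j 0 ≤ 2 * ((2 : ℝ) ^ j) ^ (β - 1) := by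
  rw [dyadicMass_fBeta_zero (by linarith), div_le_iff₀ (by linarith)]
  have : 0 ≤ ((2 : ℝ) ^ j) ^ (β - 1) := by positivity
  nlinarith

theorem dyadicMass_fBeta_le (hβ : 0 ≤ β) (hβ1 : β ≤ 1 / 2) {j k : ℕ} (hk : k < 2 ^ j) :
    dyadicMass (fBeta β) j k ≤ 2 * ((2 : ℝ) ^ j) ^ (β - 1) := by
  rcases eq_or_ne k 0 with rfl | hk0
  · exact dyadicMass_fBeta_zero_le hβ1 j
  · have h1 := (dyadicMass_fBeta_mem hβ (by linarith) hk0 hk).2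
    rw [fBeta_div_two_pow hk.le, ← le_div_iff₀' (by positivity)] at h1
    refine h1.trans ?_
    rw [two_pow_rpow_sub_one]
    have h3 : (k : ℝ) ^ (-β) ≤ 1 := Real.rpow_le_one_of_one_le_of_nonpos
      (by exact_mod_cast Nat.one_le_iff_ne_zero.2 hk0) (by linarith)
    have h4 : 0 ≤ ((2 : ℝ) ^ j) ^ β / 2 ^ j := by positivity
    calc ((2 : ℝ) ^ j) ^ β * (k : ℝ) ^ (-β) / 2 ^ j
        = (((2 : ℝ) ^ j) ^ β / 2 ^ j) * (k : ℝ) ^ (-β) := by ring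
      _ ≤ _ := by nlinarith

theorem dyadicMass_fBeta_le_two (hβ : 0 ≤ β) (hβ1 : β ≤ 1 / 2) {j k : ℕ} (hk : k < 2 ^ j) :
    dyadicMass (fBeta β) j k ≤ 2 := by
  have h1 := dyadicMass_fBeta_le hβ hβ1 hk
  have h2 : ((2 : ℝ) ^ j) ^ (β - 1) ≤ 1 :=
    Real.rpow_le_one_of_one_le_of_nonpos (one_le_pow₀ (by norm_num)) (by linarith)
  linarith

/-- For `k ≥ 1`, monotonicity places the averages over the two halves between the endpoint values of
the parent interval, whose difference is at most `2 ^ (j β) / (k + 1)`. For `k = 0` the two masses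
are nonnegative, so their difference is at most their sum. -/
theorem abs_dyadicMass_fBeta_sub_le (hβ : 0 ≤ β) (hβ1 : β ≤ 1 / 2) {j k : ℕ} (hk : k < 2 ^ j) :
    |dyadicMass (fBeta β) (j + 1) (2 * k) - dyadicMass (fBeta β) (j + 1) (2 * k + 1)|
      ≤ 2 * ((2 : ℝ) ^ j) ^ (β - 1) / (k + 1) := by
  rcases eq_or_ne k 0 with rfl | hk0
  · have h1 := dyadicMass_fBeta_zero_le hβ1 j
    rw [dyadicMass_split (integrable_fBeta (by linarith))] at h1
    have h2 := dyadicMass_fBeta_nonneg β (j + 1) (2 * 0)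
    have h3 := dyadicMass_fBeta_nonneg β (j + 1) (2 * 0 + 1)
    rw [Nat.cast_zero, zero_add, div_one, abs_le]
    constructor <;> linarith
  · have hb1 : β < 1 := by linarith
    have hj : (0 : ℝ) < 2 ^ j := by positivity
    have hk1 : 2 * k < 2 ^ (j + 1) := by rw [pow_succ]; omega
    have hk2 : 2 * k + 1 < 2 ^ (j + 1) := by rw [pow_succ]; omega
    obtain ⟨h1, h2⟩ := dyadicMass_fBeta_mem hβ hb1 (by omega) hk1
    obtain ⟨h3, h4⟩ := dyadicMass_fBeta_mem hβ hb1 (by omega) hk2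
    have e1 : ((2 * k : ℕ) : ℝ) / 2 ^ (j + 1) = k / 2 ^ j := by
      push_cast; rw [pow_succ]; field_simp
    have e2 : (((2 * k + 1 : ℕ) : ℝ) + 1) / 2 ^ (j + 1) = (k + 1) / 2 ^ j := by
      push_cast; rw [pow_succ]; field_simp; ring
    have e3 : ((2 * k + 1 : ℕ) : ℝ) / 2 ^ (j + 1) = (((2 * k : ℕ) : ℝ) + 1) / 2 ^ (j + 1) := by
      push_cast; rfl
    rw [e1] at h2
    rw [e2] at h3
    rw [e3] at h4
    have h5 := fBeta_dyadic_variation_le hβ hb1.le hk0 hk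
    have hpow : (0 : ℝ) < 2 ^ (j + 1) := by positivity
    have h6 : 0 ≤ dyadicMass (fBeta β) (j + 1) (2 * k)
        - dyadicMass (fBeta β) (j + 1) (2 * k + 1) := by
      have := (mul_le_mul_iff_right₀ hpow).1 (h4.trans h1)
      linarith
    rw [abs_of_nonneg h6, two_pow_rpow_sub_one]
    set d := dyadicMass (fBeta β) (j + 1) (2 * k) - dyadicMass (fBeta β) (j + 1) (2 * k + 1) with hd
    have h7 : 2 ^ (j + 1) * d ≤ ((2 : ℝ) ^ j) ^ β / (k + 1) := by
      rw [hd, mul_sub]; linarith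
    have h8 : 2 ^ j * d ≤ ((2 : ℝ) ^ j) ^ β / (k + 1) := by
      rw [pow_succ] at h7
      nlinarith [mul_nonneg hj.le h6]
    have h9 : d ≤ ((2 : ℝ) ^ j) ^ β / (k + 1) / 2 ^ j := by rwa [le_div_iff₀' hj]
    refine h9.trans ?_
    have h10 : 0 ≤ ((2 : ℝ) ^ j) ^ β / (k + 1) / 2 ^ j := by positivity
    calc ((2 : ℝ) ^ j) ^ β / (k + 1) / 2 ^ j ≤ 2 * (((2 : ℝ) ^ j) ^ β / (k + 1) / 2 ^ j) := by linarith
      _ = _ := by ring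

/-- Away from the singularity the variation on the interval bounds the error. At `k = 0`, `(u - f) ^
2 ≤ u ^ 2 + f ^ 2` for nonnegative terms, and `f ^ 2` is the intensity of exponent `2 β`, integrable
since `β < 1 / 2`; the two terms give `4` and `1 / (1 - 2 β)`. -/
theorem lintegral_sq_dyadic_bias_le (hβ : 0 ≤ β) (hβ1 : β < 1 / 2) {m k : ℕ} (hk : k < 2 ^ m) :
    ∫⁻ x in dyadic m k, ENNReal.ofReal ((2 ^ m * dyadicMass (fBeta β) m k - fBeta β x) ^ 2)
      ≤ ENNReal.ofReal ((4 + 1 / (1 - 2 * β)) * ((2 : ℝ) ^ m) ^ (2 * β - 1) / (k + 1) ^ 2) := by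
  have hm : (0 : ℝ) < 2 ^ m := by positivity
  have hc : 0 < 1 / (1 - 2 * β) := by
    have : 0 < 1 - 2 * β := by linarith
    positivity
  have hpow : ((2 : ℝ) ^ m) ^ (2 * β - 1) = (((2 : ℝ) ^ m) ^ β) ^ 2 / 2 ^ m := by
    rw [two_pow_rpow_sub_one, mul_comm 2 β, Real.rpow_mul hm.le]
    norm_num
  rcases eq_or_ne k 0 with rfl | hk0
  · have h1 := dyadicMass_fBeta_zero_le hβ1.le m
    have h2 := dyadicMass_fBeta_nonneg β m 0
    have h3 : 2 ^ m * dyadicMass (fBeta β) m 0 ≤ 2 * ((2 : ℝ) ^ m) ^ β := by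
      rw [two_pow_rpow_sub_one] at h1
      calc 2 ^ m * dyadicMass (fBeta β) m 0 ≤ 2 ^ m * (2 * (((2 : ℝ) ^ m) ^ β / 2 ^ m)) := by gcongr
        _ = _ := by field_simp
    have h4 : (2 ^ m * dyadicMass (fBeta β) m 0) ^ 2 ≤ 4 * (((2 : ℝ) ^ m) ^ β) ^ 2 := by
      calc _ ≤ (2 * ((2 : ℝ) ^ m) ^ β) ^ 2 := by gcongr
        _ = _ := by ring
    have hint : Integrable (fBeta (2 * β)) := integrable_fBeta (by linarith)
    calc ∫⁻ x in dyadic m 0, ENNReal.ofReal ((2 ^ m * dyadicMass (fBeta β) m 0 - fBeta β x) ^ 2)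
        ≤ ∫⁻ x in dyadic m 0, (ENNReal.ofReal (4 * (((2 : ℝ) ^ m) ^ β) ^ 2)
            + ENNReal.ofReal (fBeta (2 * β) x)) := by
          refine lintegral_mono fun x => ?_
          rw [← ENNReal.ofReal_add (by positivity) (fBeta_nonneg _ _), ← sq_fBeta]
          refine ENNReal.ofReal_le_ofReal ?_
          have h5 := fBeta_nonneg β x
          have h6 : 0 ≤ 2 ^ m * dyadicMass (fBeta β) m 0 := by positivity
          nlinarith [mul_nonneg h6 h5]
      _ = ENNReal.ofReal (4 * (((2 : ℝ) ^ m) ^ β) ^ 2 * (1 / 2 ^ m))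
            + ENNReal.ofReal (dyadicMass (fBeta (2 * β)) m 0) := by
          rw [lintegral_add_left measurable_const, setLIntegral_const, volume_dyadic,
            ← ENNReal.ofReal_mul (by positivity), dyadicMass,
            ofReal_integral_eq_lintegral_ofReal hint.integrableOn
              (Filter.Eventually.of_forall fun x => fBeta_nonneg _ x)]
      _ ≤ _ := by
          rw [← ENNReal.ofReal_add (by positivity) (dyadicMass_fBeta_nonneg _ _ _)]
          refine ENNReal.ofReal_le_ofReal (le_of_eq ?_)
          rw [dyadicMass_fBeta_zero (by linarith), hpow]
          simp only [Nat.cast_zero, zero_add, one_pow, div_one]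
          ring
  · obtain ⟨h1, h2⟩ := dyadicMass_fBeta_mem hβ (by linarith) hk0 hk
    have h3 := fBeta_dyadic_variation_le hβ (by linarith) hk0 hk
    calc ∫⁻ x in dyadic m k, ENNReal.ofReal ((2 ^ m * dyadicMass (fBeta β) m k - fBeta β x) ^ 2)
        ≤ ∫⁻ _ in dyadic m k, ENNReal.ofReal ((((2 : ℝ) ^ m) ^ β / (k + 1)) ^ 2) := by
          refine setLIntegral_mono measurable_const fun x hx => ?_
          obtain ⟨h4, h5⟩ := fBeta_le_of_mem_dyadic hβ hk0 hk hx
          refine ENNReal.ofReal_le_ofReal (sq_le_sq.2 ?_)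
          refine (abs_le.2 ⟨?_, ?_⟩).trans (le_abs_self _) <;> linarith
      _ = ENNReal.ofReal ((((2 : ℝ) ^ m) ^ β / (k + 1)) ^ 2 * (1 / 2 ^ m)) := by
          rw [setLIntegral_const, volume_dyadic, ← ENNReal.ofReal_mul (by positivity)]
      _ ≤ _ := by
          refine ENNReal.ofReal_le_ofReal ?_
          rw [hpow]
          have h6 : 0 ≤ (((2 : ℝ) ^ m) ^ β / (k + 1)) ^ 2 * (1 / 2 ^ m) := by positivity
          calc _ = 1 * ((((2 : ℝ) ^ m) ^ β / (k + 1)) ^ 2 * (1 / 2 ^ m)) := by ring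
            _ ≤ (4 + 1 / (1 - 2 * β)) * ((((2 : ℝ) ^ m) ^ β / (k + 1)) ^ 2 * (1 / 2 ^ m)) := by
                gcongr; linarith
            _ = _ := by rw [div_pow]; ring

end Intensity

/-! ### The Haar functions away from the dyadic rationals -/

/-- The dyadic rationals. -/
def dyadicRationals : Set ℝ := range fun p : ℕ × ℤ => (p.2 : ℝ) / 2 ^ p.1

theorem countable_dyadicRationals : dyadicRationals.Countable := countable_range _

theorem volume_dyadicRationals : volume dyadicRationals = 0 :=
  countable_dyadicRationals.measure_zero _

theorem measurableSet_dyadicRationals : MeasurableSet dyadicRationals :=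
  countable_dyadicRationals.measurableSet

theorem two_pow_mul_ne {x : ℝ} (hx : x ∉ dyadicRationals) (j : ℕ) (k : ℤ) : 2 ^ j * x ≠ k := by
  intro h
  refine hx ⟨(j, k), ?_⟩
  change (k : ℝ) / 2 ^ j = x
  rw [← h]; field_simp

/-- The index `(-1, 0)`. -/
def fatherIndex : Index := ⟨(-1, 0), le_rfl⟩

/-- The index `(j, k)`, for natural numbers `j` and `k`. -/
def motherIndex (j k : ℕ) : Index := ⟨((j : ℤ), (k : ℤ)), by change (-1 : ℤ) ≤ j; omega⟩

/-- The Haar step function with values `±1` on the two halves of a dyadic interval. -/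
noncomputable def haarStep (j k : ℕ) (x : ℝ) : ℝ :=
  (dyadic (j + 1) (2 * k)).indicator 1 x - (dyadic (j + 1) (2 * k + 1)).indicator 1 x

theorem indicator_dyadic_split (j k : ℕ) (x : ℝ) :
    (dyadic j k).indicator (1 : ℝ → ℝ) x = (dyadic (j + 1) (2 * k)).indicator 1 x
      + (dyadic (j + 1) (2 * k + 1)).indicator 1 x := by
  rw [← dyadic_union, indicator_union_of_disjoint (disjoint_dyadic (by omega))]

theorem sq_haarStep (j k : ℕ) (x : ℝ) :
    haarStep j k x ^ 2 = (dyadic j k).indicator 1 x := by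
  rw [indicator_dyadic_split, haarStep]
  have hd := disjoint_dyadic (j := j + 1) (show 2 * k ≠ 2 * k + 1 by omega)
  by_cases h : x ∈ dyadic (j + 1) (2 * k)
  · have h2 := Set.disjoint_left.1 hd h
    simp [h, h2]
  · by_cases h2 : x ∈ dyadic (j + 1) (2 * k + 1) <;> simp [h, h2]

theorem haarPsi_eq {y : ℝ} (h1 : y ≠ 1 / 2) (h2 : y ≠ 1) :
    haarPsi y = (Ico (0 : ℝ) (1 / 2)).indicator 1 y - (Ico (1 / 2 : ℝ) 1).indicator 1 y := by
  have e1 : y ∈ Icc (0 : ℝ) (1 / 2) ↔ y ∈ Ico (0 : ℝ) (1 / 2) := by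
    simp only [mem_Icc, mem_Ico]
    exact and_congr_right fun _ => ⟨fun h => lt_of_le_of_ne h h1, le_of_lt⟩
  have e2 : y ∈ Icc (1 / 2 : ℝ) 1 ↔ y ∈ Ico (1 / 2 : ℝ) 1 := by
    simp only [mem_Icc, mem_Ico]
    exact and_congr_right fun _ => ⟨fun h => lt_of_le_of_ne h h2, le_of_lt⟩
  unfold haarPsi
  classical
  simp only [Pi.sub_apply, indicator_apply, e1, e2]

theorem haarPsi_of_notMem {y : ℝ} (h : y ∉ Icc (0 : ℝ) 1) : haarPsi y = 0 := by
  unfold haarPsi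
  rw [Pi.sub_apply, indicator_of_notMem, indicator_of_notMem, sub_zero]
  · exact fun h2 => h ⟨(by norm_num : (0 : ℝ) ≤ 1 / 2).trans h2.1, h2.2⟩
  · exact fun h2 => h ⟨h2.1, h2.2.trans (by norm_num)⟩

theorem rpow_half_eq_sqrt (j : ℕ) : (2 : ℝ) ^ ((j : ℝ) / 2) = Real.sqrt (2 ^ j) := by
  rw [Real.sqrt_eq_rpow, ← Real.rpow_natCast, ← Real.rpow_mul (by norm_num)]
  congr 1
  ring

theorem mem_dyadic_iff {j k : ℕ} {x : ℝ} :
    x ∈ dyadic j k ↔ (k : ℝ) ≤ 2 ^ j * x ∧ 2 ^ j * x < k + 1 := by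
  unfold dyadic
  rw [mem_Ico, div_le_iff₀' (by positivity), lt_div_iff₀' (by positivity)]

/-- Closed and half-open halves differ only where `2 ^ j x - k` is `1 / 2` or `1`, hence only at
dyadic rationals. -/
theorem haar_motherIndex (j k : ℕ) {x : ℝ} (hx : x ∉ dyadicRationals) :
    haar (motherIndex j k) x = Real.sqrt (2 ^ j) * haarStep j k x := by
  have hj : (0 : ℝ) < 2 ^ j := by positivity
  have hne : ((j : ℤ)) ≠ -1 := by omega
  unfold haar motherIndex
  simp only [if_neg hne, zpow_natCast, Int.cast_natCast, rpow_half_eq_sqrt]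
  congr 1
  have a1 : 2 ^ j * x - k ≠ 1 / 2 := by
    have := two_pow_mul_ne hx (j + 1) (2 * k + 1)
    intro h; apply this
    push_cast; rw [pow_succ]; linarith
  have a2 : 2 ^ j * x - k ≠ 1 := by
    have := two_pow_mul_ne hx j (k + 1)
    intro h; apply this
    push_cast; linarith
  rw [haarPsi_eq a1 a2, haarStep]
  have hj1 : (2 : ℝ) ^ (j + 1) = 2 * 2 ^ j := by rw [pow_succ]; ring
  have e1 : 2 ^ j * x - k ∈ Ico (0 : ℝ) (1 / 2) ↔ x ∈ dyadic (j + 1) (2 * k) := by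
    rw [mem_Ico, mem_dyadic_iff, hj1]
    push_cast
    constructor <;> rintro ⟨h1, h2⟩ <;> constructor <;> linarith
  have e2 : 2 ^ j * x - k ∈ Ico (1 / 2 : ℝ) 1 ↔ x ∈ dyadic (j + 1) (2 * k + 1) := by
    rw [mem_Ico, mem_dyadic_iff, hj1]
    push_cast
    constructor <;> rintro ⟨h1, h2⟩ <;> constructor <;> linarith
  classical
  simp only [indicator_apply, e1, e2, Pi.one_apply]

theorem haar_fatherIndex {x : ℝ} (hx : x ∉ dyadicRationals) :
    haar fatherIndex x = (dyadic 0 0).indicator 1 x := by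
  have h1 : x ≠ 1 := by simpa using two_pow_mul_ne hx 0 1
  unfold haar fatherIndex haarPhi dyadic
  classical
  have e : x ∈ Icc (0 : ℝ) 1 ↔ x ∈ Ico (0 : ℝ) 1 := by
    simp only [mem_Icc, mem_Ico]
    exact and_congr_right fun _ => ⟨fun h => lt_of_le_of_ne h h1, le_of_lt⟩
  simp [indicator_apply, -mem_Icc, -mem_Ico, e]

/-- Only finitely many indices per level see the unit interval. The remaining Haar functions vanish
at every observed point, so their empirical coefficients are exactly zero. -/
theorem index_cases (l : Index) : l = fatherIndex ∨ (∃ j k, k < 2 ^ j ∧ l = motherIndex j k) ∨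
    ∀ x ∈ Icc (0 : ℝ) 1, x ∉ dyadicRationals → haar l x = 0 := by
  obtain ⟨⟨i, k⟩, hi⟩ := l
  change -1 ≤ i at hi
  have bounds : ∀ x ∈ Icc (0 : ℝ) 1, x ∉ dyadicRationals → 0 < x ∧ x < 1 := by
    intro x hx hxD
    have h1 : x ≠ 1 := by simpa using two_pow_mul_ne hxD 0 1
    have h0 : x ≠ 0 := by simpa using two_pow_mul_ne hxD 0 0
    exact ⟨lt_of_le_of_ne hx.1 h0.symm, lt_of_le_of_ne hx.2 h1⟩
  rcases eq_or_ne i (-1) with rfl | hi1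
  · rcases eq_or_ne k 0 with rfl | hk
    · exact Or.inl rfl
    · refine Or.inr (Or.inr fun x hx hxD => ?_)
      obtain ⟨h0, h1⟩ := bounds x hx hxD
      unfold haar haarPhi
      rw [if_pos rfl, indicator_of_notMem]
      rintro ⟨h2, h3⟩
      have h4 : (k : ℝ) < ((1 : ℤ) : ℝ) := by push_cast; linarith
      have h5 : ((-1 : ℤ) : ℝ) < k := by push_cast; linarith
      rw [Int.cast_lt] at h4 h5
      omega
  · obtain ⟨j, rfl⟩ : ∃ j : ℕ, i = j := ⟨i.toNat, by omega⟩
    have hj : (0 : ℝ) < 2 ^ j := by positivity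
    by_cases hk : 0 ≤ k ∧ k < 2 ^ j
    · obtain ⟨m, rfl⟩ : ∃ m : ℕ, k = m := ⟨k.toNat, by omega⟩
      exact Or.inr (Or.inl ⟨j, m, by exact_mod_cast hk.2, rfl⟩)
    · refine Or.inr (Or.inr fun x hx hxD => ?_)
      obtain ⟨h0, h1⟩ := bounds x hx hxD
      unfold haar
      simp only [if_neg hi1, zpow_natCast]
      rw [haarPsi_of_notMem, mul_zero]
      rintro ⟨h2, h3⟩
      apply hk
      have h4 : ((-1 : ℤ) : ℝ) < k := by push_cast; nlinarith
      have h5 : (k : ℝ) < ((2 ^ j : ℤ) : ℝ) := by push_cast; nlinarith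
      rw [Int.cast_lt] at h4 h5
      exact ⟨by omega, h5⟩

theorem ae_notMem_dyadicRationals : ∀ᵐ x : ℝ, x ∉ dyadicRationals :=
  measure_eq_zero_iff_ae_notMem.1 volume_dyadicRationals

theorem eLpNorm_top_eq_of_sq {g : ℝ → ℝ} {j k : ℕ} {c : ℝ} (hc : 0 ≤ c)
    (hg : ∀ᵐ x, g x ^ 2 = c ^ 2 * (dyadic j k).indicator 1 x) :
    (eLpNorm g ∞ volume).toReal = c := by
  have h1 : eLpNorm g ∞ volume = eLpNorm ((dyadic j k).indicator fun _ => c) ∞ volume := by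
    refine eLpNorm_congr_norm_ae ?_
    filter_upwards [hg] with x hx
    rw [Real.norm_eq_abs, Real.norm_eq_abs, ← sq_eq_sq_iff_abs_eq_abs, hx]
    by_cases h : x ∈ dyadic j k <;> simp [h]
  have h2 : volume (dyadic j k) ≠ 0 := by
    rw [volume_dyadic, Ne, ENNReal.ofReal_eq_zero, not_le]; positivity
  rw [h1, eLpNorm_indicator_const' (measurableSet_dyadic j k) h2 ENNReal.top_ne_zero]
  simp [abs_of_nonneg hc]

theorem haarSup_motherIndex (j k : ℕ) : haarSup (motherIndex j k) = Real.sqrt (2 ^ j) := by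
  refine eLpNorm_top_eq_of_sq (j := j) (k := k) (Real.sqrt_nonneg _) ?_
  filter_upwards [ae_notMem_dyadicRationals] with x hx
  rw [haar_motherIndex j k hx, mul_pow, sq_haarStep]

theorem haarSup_fatherIndex : haarSup fatherIndex = 1 := by
  refine eLpNorm_top_eq_of_sq (j := 0) (k := 0) zero_le_one ?_
  filter_upwards [ae_notMem_dyadicRationals] with x hx
  rw [haar_fatherIndex hx]
  by_cases h : x ∈ dyadic 0 0 <;> simp [h]

/-! ### The estimator computed from a finite set of points -/

/-- The number of points of `S` in `A`. -/
noncomputable def pointCount (S A : Set ℝ) : ℕ := (S ∩ A).encard.toNat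

theorem integral_pointMeasure (F : Finset ℝ) (h : ℝ → ℝ) :
    ∫ x, h x ∂pointMeasure (F : Set ℝ) = ∑ T ∈ F, h T := by
  unfold pointMeasure
  rw [Measure.sum_fintype, integral_finsetSum_measure fun i _ => integrable_dirac (by simp)]
  simp only [integral_dirac]
  exact Finset.sum_coe_sort F h

theorem sum_indicator_eq_pointCount (F : Finset ℝ) (A : Set ℝ) :
    ∑ T ∈ F, A.indicator (1 : ℝ → ℝ) T = pointCount F A := by
  classical
  have h : (F : Set ℝ) ∩ A = ((F.filter (· ∈ A) : Finset ℝ) : Set ℝ) := by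
    ext x; simp
  rw [pointCount, h, Set.encard_coe_eq_coe_finsetCard, ENat.toNat_natCast, Finset.card_filter]
  push_cast
  simp [indicator_apply]

theorem pointCount_empty (S : Set ℝ) : pointCount S ∅ = 0 := by simp [pointCount]

/-- Homogeneity of the threshold: with `u = h / n`, the variance estimate is `u ^ 2 (a + b)` and the
sup-norm corrections scale by `u ^ 2` too, so `u` comes out of the nested square roots and cancels
in the comparison. -/
theorem betaTilde_eq {γ c c' h : ℝ} {n : ℕ} (hn : 0 < n) {S : Set ℝ} {l : Index} {a b : ℕ}
    (hh : 0 < h) (hsup : haarSup l = h) (hβ : betaHat n S l = h / n * (a - b))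
    (hV : vHat n S l = (h / n) ^ 2 * (a + b)) (hl : l.1.1 ≤ maxLevel c c' n) :
    betaTilde γ c c' n S l = h / n * keptDiff (γ * Real.log n) a b := by
  have hn' : (0 : ℝ) < n := by exact_mod_cast hn
  have hu : 0 < h / n := by positivity
  have ht : threshold γ n S l = h / n * countThreshold (γ * Real.log n) (a + b) := by
    unfold threshold vTilde countThreshold
    rw [hsup, hV]
    set u := h / n with hud
    have e0 : h ^ 2 / (n : ℝ) ^ 2 = u ^ 2 := by rw [hud, div_pow]
    have e1 : 2 * γ * Real.log n * (u ^ 2 * ((a : ℝ) + b)) * (h ^ 2 / (n : ℝ) ^ 2)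
        = (u ^ 2) ^ 2 * (2 * (γ * Real.log n) * (a + b)) := by rw [e0]; ring
    rw [e1, Real.sqrt_mul (sq_nonneg (u ^ 2)), Real.sqrt_sq (sq_nonneg u), e0]
    have e2 : 2 * γ * (u ^ 2 * ((a : ℝ) + b) + u ^ 2 * Real.sqrt (2 * (γ * Real.log n) * (a + b))
        + 3 * γ * Real.log n * u ^ 2) * Real.log n
        = u ^ 2 * (2 * (γ * Real.log n) * (a + b + Real.sqrt (2 * (γ * Real.log n) * (a + b))
          + 3 * (γ * Real.log n))) := by ring
    rw [e2, Real.sqrt_mul (sq_nonneg u), Real.sqrt_sq hu.le, hud]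
    field_simp
  unfold betaTilde keptDiff
  rw [ht, hβ, abs_mul, abs_of_pos hu]
  simp only [hl, and_true, mul_le_mul_iff_right₀ hu]
  split_ifs <;> simp

theorem betaTilde_of_lt_level {γ c c' : ℝ} {n : ℕ} {S : Set ℝ} {l : Index}
    (hl : maxLevel c c' n < l.1.1) : betaTilde γ c c' n S l = 0 := by
  unfold betaTilde
  rw [if_neg fun h => absurd h.2 (not_le.2 hl)]

theorem betaTilde_of_betaHat_eq_zero {γ c c' : ℝ} {n : ℕ} {S : Set ℝ} {l : Index}
    (hl : betaHat n S l = 0) : betaTilde γ c c' n S l = 0 := by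
  unfold betaTilde
  rw [hl, ite_self]

section FinitePoints

variable {γ c c' : ℝ} {n : ℕ} {S : Set ℝ}

theorem betaTilde_motherIndex (hn : 0 < n) (hS : S.Finite) (hD : Disjoint S dyadicRationals)
    (j k : ℕ) (hl : (j : ℤ) ≤ maxLevel c c' n) :
    betaTilde γ c c' n S (motherIndex j k) = Real.sqrt (2 ^ j) / n *
      keptDiff (γ * Real.log n) (pointCount S (dyadic (j + 1) (2 * k)))
        (pointCount S (dyadic (j + 1) (2 * k + 1))) := by
  obtain ⟨F, rfl⟩ := hS.exists_finset_coe
  have hF : ∀ T ∈ F, T ∉ dyadicRationals := fun T hT => Set.disjoint_left.1 hD hT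
  refine betaTilde_eq hn (by positivity) (haarSup_motherIndex j k) ?_ ?_ hl
  · unfold betaHat
    rw [integral_pointMeasure, Finset.sum_congr rfl fun T hT => haar_motherIndex j k (hF T hT),
      ← Finset.mul_sum]
    simp only [haarStep, Finset.sum_sub_distrib, sum_indicator_eq_pointCount]
    ring
  · unfold vHat
    rw [integral_pointMeasure, Finset.sum_congr rfl fun T hT => by
      rw [haar_motherIndex j k (hF T hT), mul_pow, sq_haarStep, indicator_dyadic_split],
      ← Finset.mul_sum]
    simp only [Finset.sum_add_distrib, sum_indicator_eq_pointCount]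
    ring

/-- The father coefficient is treated as a difference whose second count is identically zero, so the
same scalar risk bound applies to it. -/
theorem betaTilde_fatherIndex (hn : 0 < n) (hS : S.Finite) (hD : Disjoint S dyadicRationals)
    (hl : -1 ≤ maxLevel c c' n) :
    betaTilde γ c c' n S fatherIndex = 1 / n *
      keptDiff (γ * Real.log n) (pointCount S (dyadic 0 0)) (0 : ℕ) := by
  obtain ⟨F, rfl⟩ := hS.exists_finset_coe
  have hF : ∀ T ∈ F, T ∉ dyadicRationals := fun T hT => Set.disjoint_left.1 hD hT
  refine betaTilde_eq hn one_pos haarSup_fatherIndex ?_ ?_ hl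
  · unfold betaHat
    rw [integral_pointMeasure, Finset.sum_congr rfl fun T hT => haar_fatherIndex (hF T hT),
      sum_indicator_eq_pointCount]
    simp
  · unfold vHat
    have h2 : ∀ T, (dyadic 0 0).indicator (1 : ℝ → ℝ) T ^ 2 = (dyadic 0 0).indicator 1 T := by
      intro T
      by_cases h : T ∈ dyadic 0 0 <;> simp [h]
    rw [integral_pointMeasure, Finset.sum_congr rfl fun T hT => by
      rw [haar_fatherIndex (hF T hT), h2], sum_indicator_eq_pointCount]
    simp

theorem betaHat_of_haar_eq_zero (hS : S.Finite) {l : Index} (h : ∀ T ∈ S, haar l T = 0) :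
    betaHat n S l = 0 := by
  obtain ⟨F, rfl⟩ := hS.exists_finset_coe
  unfold betaHat
  rw [integral_pointMeasure, Finset.sum_eq_zero fun T hT => h T hT, mul_zero]

theorem motherIndex_injective {j k j' k' : ℕ} (h : motherIndex j k = motherIndex j' k') :
    j = j' ∧ k = k' := by
  have h1 := congrArg (fun l : Index => l.1) h
  simp only [motherIndex, Prod.mk.injEq, Nat.cast_inj] at h1
  exact h1

/-- The estimator is a finite sum when the observed points are finitely many. -/
theorem haarEstimator_eq_sum (hS : S.Finite) (hD : Disjoint S dyadicRationals)
    (hS1 : S ⊆ Icc 0 1) {m : ℕ} (hm : maxLevel c c' n = m) (x : ℝ) :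
    haarEstimator γ c c' n S x = betaTilde γ c c' n S fatherIndex * haar fatherIndex x
      + ∑ j ∈ Finset.range (m + 1), ∑ k ∈ Finset.range (2 ^ j),
        betaTilde γ c c' n S (motherIndex j k) * haar (motherIndex j k) x := by
  classical
  set s : Finset Index := ((Finset.range (m + 1)).sigma fun j => Finset.range (2 ^ j)).image
    fun p => motherIndex p.1 p.2 with hs
  have hfs : fatherIndex ∉ s := by
    intro h
    rw [hs, Finset.mem_image] at h
    obtain ⟨p, -, hp⟩ := h
    have h1 := congrArg (fun l : Index => l.1.1) hp
    simp only [motherIndex, fatherIndex] at h1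
    omega
  unfold haarEstimator
  rw [tsum_eq_sum (s := insert fatherIndex s), Finset.sum_insert hfs, hs, Finset.sum_image,
    Finset.sum_sigma]
  · rintro ⟨j, k⟩ - ⟨j', k'⟩ - h
    obtain ⟨rfl, rfl⟩ := motherIndex_injective h
    rfl
  · intro l hl
    rw [Finset.mem_insert, not_or] at hl
    rcases index_cases l with h | ⟨j, k, hk, rfl⟩ | h
    · exact absurd h hl.1
    · rw [betaTilde_of_lt_level, zero_mul]
      rw [hm]
      by_contra hj
      refine hl.2 (Finset.mem_image.2 ⟨⟨j, k⟩, ?_, rfl⟩)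
      rw [Finset.mem_sigma, Finset.mem_range, Finset.mem_range]
      simp only [motherIndex, not_lt, Nat.cast_le] at hj
      exact ⟨by change j < m + 1; omega, hk⟩
    · rw [betaTilde_of_betaHat_eq_zero, zero_mul]
      exact betaHat_of_haar_eq_zero hS fun T hT => h T (hS1 hT) (Set.disjoint_left.1 hD hT)

end FinitePoints

/-! ### Almost sure properties of a Poisson process -/

section PoissonPoints

variable {Ω : Type*} [MeasurableSpace Ω] {P : Measure Ω}

theorem measurable_pointCount {N : Ω → Set ℝ} {μ : Measure ℝ}
    (hN : IsPoissonProcess N P μ) {A : Set ℝ} (hA : MeasurableSet A) :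
    Measurable fun ω => pointCount (N ω) A :=
  (Measurable.of_discrete (f := ENat.toNat)).comp (hN.measurable_count A hA)

theorem map_pointCount {N : Ω → Set ℝ} {μ : Measure ℝ} (hN : IsPoissonProcess N P μ) {A : Set ℝ}
    (hA : MeasurableSet A) (hμ : μ A ≠ ∞) :
    P.map (fun ω => pointCount (N ω) A) = poissonMeasure (μ A).toNNReal := by
  have h1 : (fun ω => pointCount (N ω) A) = ENat.toNat ∘ fun ω => (N ω ∩ A).encard := rfl
  rw [h1, ← Measure.map_map .of_discrete (hN.measurable_count A hA), hN.law_count A hA hμ,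
    Measure.map_map .of_discrete .of_discrete]
  have h2 : ENat.toNat ∘ (Nat.cast : ℕ → ℕ∞) = id := by ext m; simp
  rw [h2, Measure.map_id]

theorem ae_finite_inter {N : Ω → Set ℝ} {μ : Measure ℝ} (hN : IsPoissonProcess N P μ) {A : Set ℝ}
    (hA : MeasurableSet A) (hμ : μ A ≠ ∞) : ∀ᵐ ω ∂P, (N ω ∩ A).Finite := by
  have h1 : ∀ᵐ ω ∂P, (N ω ∩ A).encard ∉ ({⊤} : Set ℕ∞) := by
    refine (measure_eq_zero_iff_ae_notMem (s := (fun ω => (N ω ∩ A).encard) ⁻¹' {⊤})).1 ?_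
    rw [← Measure.map_apply (hN.measurable_count A hA) (measurableSet_singleton _),
      hN.law_count A hA hμ, Measure.map_apply .of_discrete (measurableSet_singleton _)]
    have e : (Nat.cast : ℕ → ℕ∞) ⁻¹' {⊤} = ∅ := by ext m; simp
    rw [e, measure_empty]
  filter_upwards [h1] with ω hω
  exact Set.encard_ne_top_iff.1 hω

theorem ae_inter_eq_empty {N : Ω → Set ℝ} {μ : Measure ℝ} (hN : IsPoissonProcess N P μ) {A : Set ℝ}
    (hA : MeasurableSet A) (hμ : μ A = 0) : ∀ᵐ ω ∂P, N ω ∩ A = ∅ := by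
  have hfin : μ A ≠ ∞ := by rw [hμ]; exact ENNReal.zero_ne_top
  have h0 : poissonMeasure 0 {0}ᶜ = 0 := by
    rw [prob_compl_eq_zero_iff (measurableSet_singleton _), poissonMeasure_singleton]
    simp
  have h1 : ∀ᵐ ω ∂P, (N ω ∩ A).encard ∉ ({0}ᶜ : Set ℕ∞) := by
    refine (measure_eq_zero_iff_ae_notMem (s := (fun ω => (N ω ∩ A).encard) ⁻¹' {0}ᶜ)).1 ?_
    rw [← Measure.map_apply (hN.measurable_count A hA) (measurableSet_singleton _).compl,
      hN.law_count A hA hfin, Measure.map_apply .of_discrete (measurableSet_singleton _).compl, hμ,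
      ENNReal.toNNReal_zero]
    convert! h0
    ext m; simp
  filter_upwards [h1] with ω hω
  rw [Set.notMem_compl_iff, mem_singleton_iff] at hω
  exact Set.encard_eq_zero.1 hω

theorem meanMeasure_apply (f : ℝ → ℝ) (n : ℕ) {A : Set ℝ} (hA : MeasurableSet A) :
    meanMeasure f n A = n * ∫⁻ x in A, ENNReal.ofReal (f x) := by
  rw [meanMeasure, Measure.smul_apply, withDensity_apply _ hA, smul_eq_mul]

theorem meanMeasure_apply_of_integrable {f : ℝ → ℝ} (hf : Integrable f) (h0 : ∀ x, 0 ≤ f x)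
    (n : ℕ) {A : Set ℝ} (hA : MeasurableSet A) :
    meanMeasure f n A = ENNReal.ofReal (n * ∫ x in A, f x) := by
  rw [meanMeasure_apply f n hA, ENNReal.ofReal_mul n.cast_nonneg, ENNReal.ofReal_natCast,
    ofReal_integral_eq_lintegral_ofReal hf.integrableOn (Filter.Eventually.of_forall h0)]

theorem map_pointCount_dyadic {f : ℝ → ℝ} (hf : Integrable f) (h0 : ∀ x, 0 ≤ f x) {n : ℕ}
    {N : Ω → Set ℝ} (hN : IsPoissonProcess N P (meanMeasure f n)) (j k : ℕ) :
    P.map (fun ω => pointCount (N ω) (dyadic j k))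
      = poissonMeasure (n * dyadicMass f j k).toNNReal := by
  have h := meanMeasure_apply_of_integrable hf h0 n (measurableSet_dyadic j k)
  rw [map_pointCount hN (measurableSet_dyadic j k) (by rw [h]; exact ENNReal.ofReal_ne_top), h]
  rfl

/-- The total mass is finite, and the dyadic rationals and the complement of `[0, 1]` have mean
measure zero; a Poisson count of mean zero is almost surely zero. -/
theorem ae_good_points {β : ℝ} (hβ : β < 1) {n : ℕ} {N : Ω → Set ℝ}
    (hN : IsPoissonProcess N P (meanMeasure (fBeta β) n)) :
    ∀ᵐ ω ∂P, (N ω).Finite ∧ Disjoint (N ω) dyadicRationals ∧ N ω ⊆ Icc 0 1 := by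
  have hμ := fun {A} hA => meanMeasure_apply_of_integrable (integrable_fBeta hβ)
    (fBeta_nonneg β) n (A := A) hA
  have h1 := ae_finite_inter hN MeasurableSet.univ
    (by rw [hμ MeasurableSet.univ]; exact ENNReal.ofReal_ne_top)
  have h2 := ae_inter_eq_empty hN measurableSet_dyadicRationals (by
    rw [meanMeasure_apply _ _ measurableSet_dyadicRationals,
      setLIntegral_measure_zero _ _ volume_dyadicRationals, mul_zero])
  have h3 := ae_inter_eq_empty hN (measurableSet_Icc (a := (0 : ℝ)) (b := 1)).compl (by
    rw [hμ measurableSet_Icc.compl, setIntegral_eq_zero_of_forall_eq_zero, mul_zero,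
      ENNReal.ofReal_zero]
    exact fun x hx => fBeta_of_notMem hx)
  filter_upwards [h1, h2, h3] with ω a1 a2 a3
  rw [inter_univ] at a1
  refine ⟨a1, Set.disjoint_iff_inter_eq_empty.2 a2, ?_⟩
  rwa [← Set.disjoint_iff_inter_eq_empty, Set.disjoint_compl_right_iff_subset] at a3

end PoissonPoints

/-! ### Upper bounds for integrals of nonnegative functions -/

/-- `g` is a nonnegative measurable function with integral at most `G`. -/
structure IntegralLE {α : Type*} [MeasurableSpace α] (μ : Measure α) (g : α → ℝ) (G : ℝ) :
    Prop where
  measurable : Measurable g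
  nonneg : ∀ a, 0 ≤ g a
  bound_nonneg : 0 ≤ G
  le : ∫⁻ a, ENNReal.ofReal (g a) ∂μ ≤ ENNReal.ofReal G

namespace IntegralLE

variable {α : Type*} [MeasurableSpace α] {μ : Measure α} {g h : α → ℝ} {G H : ℝ}

theorem add (hg : IntegralLE μ g G) (hh : IntegralLE μ h H) :
    IntegralLE μ (fun a => g a + h a) (G + H) where
  measurable := hg.measurable.add hh.measurable
  nonneg a := add_nonneg (hg.nonneg a) (hh.nonneg a)
  bound_nonneg := add_nonneg hg.bound_nonneg hh.bound_nonneg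
  le := by
    simp_rw [fun a => ENNReal.ofReal_add (hg.nonneg a) (hh.nonneg a)]
    rw [lintegral_add_left hg.measurable.ennreal_ofReal,
      ENNReal.ofReal_add hg.bound_nonneg hh.bound_nonneg]
    exact add_le_add hg.le hh.le

theorem const_mul {c : ℝ} (hc : 0 ≤ c) (hg : IntegralLE μ g G) :
    IntegralLE μ (fun a => c * g a) (c * G) where
  measurable := hg.measurable.const_mul c
  nonneg a := mul_nonneg hc (hg.nonneg a)
  bound_nonneg := mul_nonneg hc hg.bound_nonneg
  le := by
    simp_rw [fun a => ENNReal.ofReal_mul (q := g a) hc]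
    rw [lintegral_const_mul _ hg.measurable.ennreal_ofReal, ENNReal.ofReal_mul hc]
    gcongr
    exact hg.le

theorem zero (μ : Measure α) : IntegralLE μ (fun _ => 0) 0 where
  measurable := measurable_const
  nonneg _ := le_rfl
  bound_nonneg := le_rfl
  le := by simp

theorem const [IsProbabilityMeasure μ] {c : ℝ} (hc : 0 ≤ c) : IntegralLE μ (fun _ => c) c where
  measurable := measurable_const
  nonneg _ := hc
  bound_nonneg := hc
  le := by simp

theorem sum {ι : Type*} (s : Finset ι) {g : ι → α → ℝ} {G : ι → ℝ}
    (hg : ∀ i ∈ s, IntegralLE μ (g i) (G i)) :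
    IntegralLE μ (fun a => ∑ i ∈ s, g i a) (∑ i ∈ s, G i) := by
  classical
  induction s using Finset.induction_on with
  | empty => simpa using zero μ
  | insert i s hi ih =>
    simp only [Finset.sum_insert hi]
    exact (hg i (Finset.mem_insert_self i s)).add
      (ih fun j hj => hg j (Finset.mem_insert_of_mem hj))

theorem mono_bound (hg : IntegralLE μ g G) (h : G ≤ H) : IntegralLE μ g H where
  measurable := hg.measurable
  nonneg := hg.nonneg
  bound_nonneg := hg.bound_nonneg.trans h
  le := hg.le.trans (ENNReal.ofReal_le_ofReal h)

theorem lintegral_le_of_ae_le (hg : IntegralLE μ g G) {F : α → ℝ≥0∞}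
    (hF : ∀ᵐ a ∂μ, F a ≤ ENNReal.ofReal (g a)) : ∫⁻ a, F a ∂μ ≤ ENNReal.ofReal G :=
  (lintegral_mono_ae hF).trans hg.le

end IntegralLE

theorem eLpNorm_two_sq_eq_lintegral {α : Type*} [MeasurableSpace α] (μ : Measure α) (g : α → ℝ) :
    eLpNorm g 2 μ ^ 2 = ∫⁻ a, ENNReal.ofReal (g a ^ 2) ∂μ := by
  have h := eLpNorm_nnreal_pow_eq_lintegral (f := g) (μ := μ) (p := 2) two_ne_zero
  have e : ((2 : ℝ≥0) : ℝ) = ((2 : ℕ) : ℝ) := by norm_num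
  rw [e] at h
  simp only [ENNReal.rpow_natCast] at h
  refine Eq.trans ?_ (h.trans (lintegral_congr fun a => ?_))
  · norm_num
  · rw [Real.enorm_eq_ofReal_abs, ← ENNReal.ofReal_pow (abs_nonneg _), sq_abs]

/-! ### Dyadic averages and levels of the Haar expansion -/

/-- A combination of the Haar functions of level `j` on the unit interval. -/
noncomputable def levelSum (a : ℕ → ℕ → ℝ) (j : ℕ) (x : ℝ) : ℝ :=
  ∑ k ∈ Finset.range (2 ^ j), a j k * (Real.sqrt (2 ^ j) * haarStep j k x)

/-- The averages of `f` over the dyadic intervals of level `m` in the unit interval. -/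
noncomputable def dyadicAverage (f : ℝ → ℝ) (m : ℕ) (x : ℝ) : ℝ :=
  ∑ k ∈ Finset.range (2 ^ m), 2 ^ m * dyadicMass f m k * (dyadic m k).indicator 1 x

/-- The Haar coefficient of index `(j, k)`. -/
noncomputable def haarCoeff (f : ℝ → ℝ) (j k : ℕ) : ℝ :=
  Real.sqrt (2 ^ j) * (dyadicMass f (j + 1) (2 * k) - dyadicMass f (j + 1) (2 * k + 1))

theorem sum_range_two_mul (g : ℕ → ℝ) (n : ℕ) :
    ∑ i ∈ Finset.range (2 * n), g i = ∑ k ∈ Finset.range n, (g (2 * k) + g (2 * k + 1)) := by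
  induction n with
  | zero => simp
  | succ n ih =>
    rw [Finset.sum_range_succ _ n, ← ih, show 2 * (n + 1) = 2 * n + 1 + 1 by ring,
      Finset.sum_range_succ, Finset.sum_range_succ]
    ring

/-- On each half, the average equals the parent average plus or minus half the difference of the two
averages. Telescoping this identity gives the Haar expansion with no appeal to completeness or
orthogonality. -/
theorem dyadicAverage_succ {f : ℝ → ℝ} (hf : Integrable f) (j : ℕ) (x : ℝ) :
    dyadicAverage f (j + 1) x = dyadicAverage f j x + levelSum (haarCoeff f) j x := by
  unfold dyadicAverage levelSum
  rw [pow_succ, mul_comm (2 ^ j) 2, sum_range_two_mul, ← Finset.sum_add_distrib]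
  refine Finset.sum_congr rfl fun k _ => ?_
  have hs : Real.sqrt (2 ^ j) * Real.sqrt (2 ^ j) = 2 ^ j := Real.mul_self_sqrt (by positivity)
  rw [dyadicMass_split hf j k, indicator_dyadic_split j k, haarCoeff, haarStep]
  set F₁ := dyadicMass f (j + 1) (2 * k)
  set F₂ := dyadicMass f (j + 1) (2 * k + 1)
  set i₁ := (dyadic (j + 1) (2 * k)).indicator (1 : ℝ → ℝ) x
  set i₂ := (dyadic (j + 1) (2 * k + 1)).indicator (1 : ℝ → ℝ) x
  linear_combination -((F₁ - F₂) * (i₁ - i₂)) * hs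

theorem dyadicAverage_eq_sum {f : ℝ → ℝ} (hf : Integrable f) (m : ℕ) (x : ℝ) :
    dyadicAverage f m x = dyadicMass f 0 0 * (dyadic 0 0).indicator 1 x
      + ∑ j ∈ Finset.range m, levelSum (haarCoeff f) j x := by
  induction m with
  | zero => simp [dyadicAverage]
  | succ m ih => rw [dyadicAverage_succ hf, ih, Finset.sum_range_succ]; ring

theorem measurable_dyadicAverage (f : ℝ → ℝ) (m : ℕ) : Measurable (dyadicAverage f m) :=
  Finset.measurable_fun_sum _ fun _ _ =>
    (measurable_one.indicator (measurableSet_dyadic _ _)).const_mul _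

theorem haarStep_mul_haarStep {j k l : ℕ} (h : k ≠ l) (x : ℝ) :
    haarStep j k x * haarStep j l x = 0 := by
  have hz : ∀ i, x ∉ dyadic j i → haarStep j i x = 0 := by
    intro i hi
    have := sq_haarStep j i x
    rw [indicator_of_notMem hi] at this
    exact pow_eq_zero_iff two_ne_zero |>.1 this
  by_cases hx : x ∈ dyadic j k
  · rw [hz l (Set.disjoint_left.1 (disjoint_dyadic h) hx), mul_zero]
  · rw [hz k hx, zero_mul]

/-- Within one level the supports are disjoint, so all cross products vanish pointwise. -/
theorem sq_levelSum (a : ℕ → ℕ → ℝ) (j : ℕ) (x : ℝ) :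
    levelSum a j x ^ 2
      = ∑ k ∈ Finset.range (2 ^ j), a j k ^ 2 * 2 ^ j * (dyadic j k).indicator 1 x := by
  have hs : Real.sqrt (2 ^ j) ^ 2 = 2 ^ j := Real.sq_sqrt (by positivity)
  unfold levelSum
  rw [sq, Finset.sum_mul_sum]
  refine Finset.sum_congr rfl fun k hk => ?_
  rw [Finset.sum_eq_single_of_mem k hk]
  · rw [← sq_haarStep]
    linear_combination (a j k ^ 2 * haarStep j k x ^ 2) * hs
  · intro l _ hl
    have := haarStep_mul_haarStep (j := j) hl.symm x
    linear_combination (a j k * a j l * Real.sqrt (2 ^ j) ^ 2) * this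

theorem integralLE_indicator_dyadic (j k : ℕ) :
    IntegralLE volume ((dyadic j k).indicator 1) (1 / 2 ^ j) where
  measurable := measurable_one.indicator (measurableSet_dyadic _ _)
  nonneg x := indicator_nonneg (fun _ _ => zero_le_one) x
  bound_nonneg := by positivity
  le := by
    have h : ∀ x, ENNReal.ofReal ((dyadic j k).indicator 1 x) = (dyadic j k).indicator 1 x := by
      intro x
      by_cases hx : x ∈ dyadic j k <;> simp [hx]
    simp_rw [h]
    rw [lintegral_indicator_one (measurableSet_dyadic _ _), volume_dyadic]

theorem integralLE_sq_levelSum (a : ℕ → ℕ → ℝ) (j : ℕ) :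
    IntegralLE volume (fun x => levelSum a j x ^ 2) (∑ k ∈ Finset.range (2 ^ j), a j k ^ 2) := by
  simp_rw [sq_levelSum]
  refine IntegralLE.sum _ fun k _ => ?_
  have h := (integralLE_indicator_dyadic j k).const_mul (c := a j k ^ 2 * 2 ^ j) (by positivity)
  refine h.mono_bound (le_of_eq ?_)
  field_simp

theorem dyadicAverage_of_mem {f : ℝ → ℝ} {m k : ℕ} (hk : k < 2 ^ m) {x : ℝ} (hx : x ∈ dyadic m k) :
    dyadicAverage f m x = 2 ^ m * dyadicMass f m k := by
  unfold dyadicAverage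
  rw [Finset.sum_eq_single_of_mem k (Finset.mem_range.2 hk)]
  · simp [hx]
  · intro l _ hl
    rw [indicator_of_notMem (Set.disjoint_left.1 (disjoint_dyadic hl.symm) hx), mul_zero]

theorem dyadicAverage_of_notMem {f : ℝ → ℝ} {m : ℕ} {x : ℝ} (hx : x ∉ Ico (0 : ℝ) 1) :
    dyadicAverage f m x = 0 := by
  refine Finset.sum_eq_zero fun k hk => ?_
  rw [indicator_of_notMem fun h => hx (dyadic_subset_unit (Finset.mem_range.1 hk) h), mul_zero]

/-- The squared `L²`-distance of `x ^ (-β)` to its dyadic averages. -/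
theorem integralLE_sq_dyadicAverage_sub {β : ℝ} (hβ : 0 ≤ β) (hβ1 : β < 1 / 2) (m : ℕ) {B : ℝ}
    (hB : ∀ K : ℕ, ∑ k ∈ Finset.range K, 1 / ((k : ℝ) + 1) ^ 2 ≤ B) :
    IntegralLE volume (fun x => (dyadicAverage (fBeta β) m x - fBeta β x) ^ 2)
      ((4 + 1 / (1 - 2 * β)) * ((2 : ℝ) ^ m) ^ (2 * β - 1) * B) := by
  have hc : 0 < 1 / (1 - 2 * β) := by
    have : 0 < 1 - 2 * β := by linarith
    positivity
  have hB0 : 0 ≤ B := by simpa using hB 0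
  refine ⟨((measurable_dyadicAverage _ _).sub (measurable_fBeta β)).pow_const 2,
    fun x => sq_nonneg _, by positivity, ?_⟩
  set g : ℝ → ℝ≥0∞ := fun x =>
    ENNReal.ofReal ((dyadicAverage (fBeta β) m x - fBeta β x) ^ 2) with hg
  set G : ℕ → ℝ → ℝ≥0∞ := fun k x =>
    ENNReal.ofReal ((2 ^ m * dyadicMass (fBeta β) m k - fBeta β x) ^ 2) with hG
  have hGm : ∀ k, Measurable (G k) := fun k =>
    (((measurable_fBeta β).const_sub _).pow_const 2).ennreal_ofReal
  have h1 : ∀ᵐ x : ℝ, g x ≤ ∑ k ∈ Finset.range (2 ^ m), (dyadic m k).indicator (G k) x := by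
    -- The dyadic intervals cover `[0, 1)`, while the intensity lives on the closed interval.
    have hne : ∀ᵐ x : ℝ, x ≠ 1 := by
      rw [ae_iff]; simp
    filter_upwards [hne] with x hx
    by_cases hx01 : x ∈ Ico (0 : ℝ) 1
    · obtain ⟨k, hk, hxk⟩ := exists_mem_dyadic m hx01.1 hx01.2
      refine le_trans (le_of_eq ?_) (Finset.single_le_sum (f := fun k =>
        (dyadic m k).indicator (G k) x) (fun i _ => zero_le) (Finset.mem_range.2 hk))
      simp only [indicator_of_mem hxk, hg, hG, dyadicAverage_of_mem hk hxk]
    · have hx2 : x ∉ Icc (0 : ℝ) 1 := fun h => hx01 ⟨h.1, lt_of_le_of_ne h.2 hx⟩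
      rw [hg]
      simp [dyadicAverage_of_notMem hx01, fBeta_of_notMem hx2]
  calc ∫⁻ x, g x ≤ ∫⁻ x, ∑ k ∈ Finset.range (2 ^ m), (dyadic m k).indicator (G k) x :=
        lintegral_mono_ae h1
    _ = ∑ k ∈ Finset.range (2 ^ m), ∫⁻ x in dyadic m k, G k x := by
        rw [lintegral_finsetSum _ fun k _ => (hGm k).indicator (measurableSet_dyadic _ _)]
        exact Finset.sum_congr rfl fun k _ => lintegral_indicator (measurableSet_dyadic _ _) _
    _ ≤ ∑ k ∈ Finset.range (2 ^ m), ENNReal.ofReal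
          ((4 + 1 / (1 - 2 * β)) * ((2 : ℝ) ^ m) ^ (2 * β - 1) / (k + 1) ^ 2) :=
        Finset.sum_le_sum fun k hk =>
          lintegral_sq_dyadic_bias_le hβ hβ1 (Finset.mem_range.1 hk)
    _ ≤ _ := by
        rw [← ENNReal.ofReal_sum_of_nonneg fun k _ => by positivity]
        refine ENNReal.ofReal_le_ofReal ?_
        simp_rw [div_eq_mul_one_div (_ * _ : ℝ) (_ ^ 2)]
        rw [← Finset.mul_sum]
        exact mul_le_mul_of_nonneg_left (hB _) (by positivity)

/-! ### Decomposition of the loss -/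

/-- Cauchy–Schwarz after writing each `g j` as `v j ^ (-1/2)` times `v j ^ (1/2) * g j`. It replaces
orthogonality between levels. -/
theorem sq_sum_le_weighted {s : Finset ℕ} {g v : ℕ → ℝ} (hv : ∀ j, 0 < v j) {W : ℝ}
    (hW : ∑ j ∈ s, 1 / v j ≤ W) :
    (∑ j ∈ s, g j) ^ 2 ≤ W * ∑ j ∈ s, v j * g j ^ 2 := by
  refine (Finset.sum_sq_le_sum_mul_sum_of_sq_le_mul s (f := fun j => 1 / v j)
    (g := fun j => v j * g j ^ 2) (fun j _ => (one_div_pos.2 (hv j)).le)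
    (fun j _ => mul_nonneg (hv j).le (sq_nonneg _)) fun j _ => le_of_eq ?_).trans ?_
  · rw [one_div_mul_eq_div, mul_div_cancel_left₀ _ (hv j).ne']
  · exact mul_le_mul_of_nonneg_right hW
      (Finset.sum_nonneg fun j _ => mul_nonneg (hv j).le (sq_nonneg _))

theorem levelSum_sub (a b : ℕ → ℕ → ℝ) (j : ℕ) (x : ℝ) :
    levelSum (fun j k => a j k - b j k) j x = levelSum a j x - levelSum b j x := by
  unfold levelSum
  rw [← Finset.sum_sub_distrib]
  exact Finset.sum_congr rfl fun k _ => by ring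

/-- The `L²`-loss of a finite Haar expansion, with a weighted sum over the levels in place of
orthogonality. -/
theorem eLpNorm_sq_expansion_sub_le {f g : ℝ → ℝ} (hf : Integrable f) {b₀ : ℝ} {b : ℕ → ℕ → ℝ}
    {J m : ℕ} (hJm : J ≤ m)
    (hg : ∀ᵐ x, g x = b₀ * (dyadic 0 0).indicator 1 x + ∑ j ∈ Finset.range m, levelSum b j x)
    {v : ℕ → ℝ} (hv : ∀ j, 0 < v j) {W : ℝ} (hW : ∀ s : Finset ℕ, ∑ j ∈ s, 1 / v j ≤ W)
    {B : ℝ} (hB : IntegralLE volume (fun x => (dyadicAverage f J x - f x) ^ 2) B) :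
    eLpNorm (fun x => g x - f x) 2 volume ^ 2 ≤ ENNReal.ofReal (4 * ((b₀ - dyadicMass f 0 0) ^ 2
      + W * ∑ j ∈ Finset.range J, v j * ∑ k ∈ Finset.range (2 ^ j), (b j k - haarCoeff f j k) ^ 2
      + W * ∑ j ∈ Finset.Ico J m, v j * ∑ k ∈ Finset.range (2 ^ j), b j k ^ 2 + B)) := by
  have hW0 : 0 ≤ W := by simpa using hW ∅
  have i1 : IntegralLE volume
      (fun x => (b₀ - dyadicMass f 0 0) ^ 2 * (dyadic 0 0).indicator 1 x)
      ((b₀ - dyadicMass f 0 0) ^ 2) := by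
    refine ((integralLE_indicator_dyadic 0 0).const_mul (sq_nonneg _)).mono_bound (le_of_eq ?_)
    simp
  have i2 : IntegralLE volume (fun x => W * ∑ j ∈ Finset.range J,
      v j * levelSum (fun j k => b j k - haarCoeff f j k) j x ^ 2)
      (W * ∑ j ∈ Finset.range J, v j * ∑ k ∈ Finset.range (2 ^ j),
        (b j k - haarCoeff f j k) ^ 2) :=
    (IntegralLE.sum _ fun j _ => (integralLE_sq_levelSum _ j).const_mul (hv j).le).const_mul hW0
  have i3 : IntegralLE volume (fun x => W * ∑ j ∈ Finset.Ico J m, v j * levelSum b j x ^ 2)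
      (W * ∑ j ∈ Finset.Ico J m, v j * ∑ k ∈ Finset.range (2 ^ j), b j k ^ 2) :=
    (IntegralLE.sum _ fun j _ => (integralLE_sq_levelSum _ j).const_mul (hv j).le).const_mul hW0
  rw [eLpNorm_two_sq_eq_lintegral]
  refine ((((i1.add i2).add i3).add hB).const_mul (c := 4) (by norm_num)).lintegral_le_of_ae_le ?_
  filter_upwards [hg] with x hx
  refine ENNReal.ofReal_le_ofReal ?_
  -- Below `J` the kept coefficients are compared with the true ones; from `J` on they count as pure
  -- error, and the true coefficients there belong to the distance of `f` from its averages at level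
  -- `J`.
  have e : g x - f x = (b₀ - dyadicMass f 0 0) * (dyadic 0 0).indicator 1 x
      + ∑ j ∈ Finset.range J, levelSum (fun j k => b j k - haarCoeff f j k) j x
      + ∑ j ∈ Finset.Ico J m, levelSum b j x + (dyadicAverage f J x - f x) := by
    rw [hx, dyadicAverage_eq_sum hf]
    simp only [levelSum_sub, Finset.sum_sub_distrib]
    rw [← Finset.sum_range_add_sum_Ico _ hJm]
    ring
  have h1 : ((b₀ - dyadicMass f 0 0) * (dyadic 0 0).indicator 1 x) ^ 2
      = (b₀ - dyadicMass f 0 0) ^ 2 * (dyadic 0 0).indicator 1 x := by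
    by_cases h : x ∈ dyadic 0 0 <;> simp [h]
  have h2 := sq_sum_le_weighted
    (g := fun j => levelSum (fun j k => b j k - haarCoeff f j k) j x) hv (hW (Finset.range J))
  have h3 := sq_sum_le_weighted (g := fun j => levelSum b j x) hv (hW (Finset.Ico J m))
  rw [e, ← h1]
  refine le_trans ?_ (mul_le_mul_of_nonneg_left
    (add_le_add (add_le_add (add_le_add le_rfl h2) h3) le_rfl) (by norm_num))
  generalize (b₀ - dyadicMass f 0 0) * (dyadic 0 0).indicator 1 x = A
  generalize ∑ j ∈ Finset.range J, levelSum (fun j k => b j k - haarCoeff f j k) j x = A'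
  generalize ∑ j ∈ Finset.Ico J m, levelSum b j x = A''
  generalize dyadicAverage f J x - f x = A'''
  nlinarith [sq_nonneg (A - A'), sq_nonneg (A - A''), sq_nonneg (A - A'''), sq_nonneg (A' - A''),
    sq_nonneg (A' - A'''), sq_nonneg (A'' - A''')]

/-! ### The risk of the thresholding estimator -/

/-- The bound for the mean squared error of a thresholded difference of two Poisson variables
with means `p` and `q`. -/
noncomputable def diffRisk (x p q : ℝ) : ℝ :=
  min ((p - q) ^ 2) (90 * (x * (p + q))) + 500 * Real.exp (-x / 128) * (p + q + 1) ^ 4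

theorem diffRisk_nonneg {x p q : ℝ} (hx : 0 ≤ x) (hp : 0 ≤ p) (hq : 0 ≤ q) :
    0 ≤ diffRisk x p q := by
  have : 0 ≤ min ((p - q) ^ 2) (90 * (x * (p + q))) := le_min (by positivity) (by positivity)
  unfold diffRisk
  positivity

section Risk

variable {Ω : Type*} [MeasurableSpace Ω] {P : Measure Ω} {A B : Ω → ℕ} {p q : ℝ}

theorem measurable_comp_counts (hA : Measurable A) (hB : Measurable B) (g : ℕ → ℕ → ℝ) :
    Measurable fun ω => g (A ω) (B ω) :=
  (Measurable.of_discrete (f := fun z : ℕ × ℕ => g z.1 z.2)).comp (hA.prodMk hB)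

theorem integralLE_sq_keptDiff_sub [IsProbabilityMeasure P] (hA : Measurable A) (hB : Measurable B)
    (hp : 0 ≤ p) (hq : 0 ≤ q) (hAp : P.map A = poissonMeasure p.toNNReal)
    (hBq : P.map B = poissonMeasure q.toNNReal) {x : ℝ} (hx : 0 < x) :
    IntegralLE P (fun ω => (keptDiff x (A ω) (B ω) - (p - q)) ^ 2) (diffRisk x p q) where
  measurable := measurable_comp_counts hA hB fun a b => (keptDiff x a b - (p - q)) ^ 2
  nonneg _ := sq_nonneg _
  bound_nonneg := diffRisk_nonneg hx.le hp hq
  le := by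
    have h := lintegral_sq_keptDiff_sub_le hA hB hAp hBq hx
    rw [Real.coe_toNNReal p hp, Real.coe_toNNReal q hq] at h
    exact h

theorem integralLE_sq_keptDiff (hA : Measurable A) (hB : Measurable B)
    (hp : 0 ≤ p) (hq : 0 ≤ q) (hAp : P.map A = poissonMeasure p.toNNReal)
    (hBq : P.map B = poissonMeasure q.toNNReal) {x : ℝ} (hx : 0 < x) {d : ℕ} (hd : (d : ℝ) ≤ x)
    {t : ℝ} (ht : 1 ≤ t) (hpt : p * t ≤ 1) (hqt : q * t ≤ 1) :
    IntegralLE P (fun ω => keptDiff x (A ω) (B ω) ^ 2) (100 / t ^ d) where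
  measurable := measurable_comp_counts hA hB fun a b => keptDiff x a b ^ 2
  nonneg _ := sq_nonneg _
  bound_nonneg := by positivity
  le := lintegral_sq_keptDiff_le hA hB hAp hBq hx hd ht
    (by rwa [Real.coe_toNNReal p hp]) (by rwa [Real.coe_toNNReal q hq])

end Risk

/-- For almost every realization the squared norm is bounded by a finite sum of squared coefficient
errors, each a function of two counts. Integrating that sum avoids any joint measurability of the
estimator in `x` and `ω`. -/
theorem lintegral_eLpNorm_sq_haarEstimator_sub_le {Ω : Type*} [MeasurableSpace Ω] {P : Measure Ω}
    [IsProbabilityMeasure P] {β γ c c' : ℝ} (hβ : β < 1) {n : ℕ} (hn : 0 < n)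
    {N : Ω → Set ℝ} (hN : IsPoissonProcess N P (meanMeasure (fBeta β) n))
    {m : ℕ} (hm : maxLevel c c' n = m) {d : ℕ} (hd : (d : ℝ) ≤ γ * Real.log n)
    (hx : 0 < γ * Real.log n) {J : ℕ} (hJ : J ≤ m + 1)
    {v : ℕ → ℝ} (hv : ∀ j, 0 < v j) {W : ℝ} (hW : ∀ s : Finset ℕ, ∑ j ∈ s, 1 / v j ≤ W)
    {B : ℝ} (hB : IntegralLE volume (fun x => (dyadicAverage (fBeta β) J x - fBeta β x) ^ 2) B)
    {t : ℕ → ℝ} (ht : ∀ j ∈ Finset.Ico J (m + 1), 1 ≤ t j)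
    (htm : ∀ j ∈ Finset.Ico J (m + 1), ∀ k < 2 ^ (j + 1),
      n * dyadicMass (fBeta β) (j + 1) k * t j ≤ 1) :
    ∫⁻ ω, eLpNorm (fun x => haarEstimator γ c c' n (N ω) x - fBeta β x) 2 volume ^ 2 ∂P
      ≤ ENNReal.ofReal (4 * ((1 / n) ^ 2
            * diffRisk (γ * Real.log n) (n * dyadicMass (fBeta β) 0 0) 0
        + W * ∑ j ∈ Finset.range J, v j * ∑ k ∈ Finset.range (2 ^ j), (Real.sqrt (2 ^ j) / n) ^ 2
            * diffRisk (γ * Real.log n) (n * dyadicMass (fBeta β) (j + 1) (2 * k))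
              (n * dyadicMass (fBeta β) (j + 1) (2 * k + 1))
        + W * ∑ j ∈ Finset.Ico J (m + 1), v j * ∑ _k ∈ Finset.range (2 ^ j),
            (Real.sqrt (2 ^ j) / n) ^ 2 * (100 / t j ^ d) + B)) := by
  have hW0 : 0 ≤ W := by simpa using hW ∅
  have hn' : (0 : ℝ) < n := by exact_mod_cast hn
  have hf := integrable_fBeta hβ
  have hmass : ∀ j k, 0 ≤ n * dyadicMass (fBeta β) j k := fun j k =>
    mul_nonneg hn'.le (dyadicMass_fBeta_nonneg β j k)
  set x := γ * Real.log n with hxd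
  set X : ℕ → ℕ → Ω → ℕ := fun j k ω => pointCount (N ω) (dyadic j k) with hX
  have hXm : ∀ j k, Measurable (X j k) := fun j k =>
    measurable_pointCount hN (measurableSet_dyadic j k)
  have hXl : ∀ j k, P.map (X j k) = poissonMeasure (n * dyadicMass (fBeta β) j k).toNNReal :=
    fun j k => map_pointCount_dyadic hf (fBeta_nonneg β) hN j k
  set b₀ : Ω → ℝ := fun ω => 1 / n * keptDiff x (X 0 0 ω) (0 : ℕ) with hb₀
  set b : Ω → ℕ → ℕ → ℝ := fun ω j k => Real.sqrt (2 ^ j) / n *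
    keptDiff x (X (j + 1) (2 * k) ω) (X (j + 1) (2 * k + 1) ω) with hb
  -- The count in the empty set is the constant `0`, and has the Poisson law of mean `0`.
  have hzero : P.map (fun _ : Ω => (0 : ℕ)) = poissonMeasure (0 : ℝ).toNNReal := by
    have h := map_pointCount hN MeasurableSet.empty (by simp)
    simpa [pointCount_empty] using h
  have i1 : IntegralLE P (fun ω => (b₀ ω - dyadicMass (fBeta β) 0 0) ^ 2)
      ((1 / n) ^ 2 * diffRisk x (n * dyadicMass (fBeta β) 0 0) 0) := by
    have h := (integralLE_sq_keptDiff_sub (hXm 0 0) measurable_const (hmass 0 0) le_rfl (hXl 0 0)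
      hzero hx).const_mul (c := (1 / (n : ℝ)) ^ 2) (by positivity)
    convert! h using 2 with ω
    rw [hb₀, ← mul_pow]
    congr 1
    field_simp
    ring
  have i2 : ∀ j k, IntegralLE P (fun ω => (b ω j k - haarCoeff (fBeta β) j k) ^ 2)
      ((Real.sqrt (2 ^ j) / n) ^ 2 * diffRisk x (n * dyadicMass (fBeta β) (j + 1) (2 * k))
        (n * dyadicMass (fBeta β) (j + 1) (2 * k + 1))) := by
    intro j k
    have h := (integralLE_sq_keptDiff_sub (hXm (j + 1) (2 * k)) (hXm (j + 1) (2 * k + 1))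
      (hmass _ _) (hmass _ _) (hXl _ _) (hXl _ _) hx).const_mul
      (c := (Real.sqrt (2 ^ j) / n) ^ 2) (by positivity)
    convert! h using 2 with ω
    rw [hb, haarCoeff, ← mul_pow]
    congr 1
    field_simp
  have i3 : ∀ j ∈ Finset.Ico J (m + 1), ∀ k ∈ Finset.range (2 ^ j),
      IntegralLE P (fun ω => b ω j k ^ 2) ((Real.sqrt (2 ^ j) / n) ^ 2 * (100 / t j ^ d)) := by
    intro j hj k hk
    have hk' := Finset.mem_range.1 hk
    have hk1 : 2 * k < 2 ^ (j + 1) := by rw [pow_succ]; omega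
    have hk2 : 2 * k + 1 < 2 ^ (j + 1) := by rw [pow_succ]; omega
    have h := (integralLE_sq_keptDiff (hXm (j + 1) (2 * k)) (hXm (j + 1) (2 * k + 1))
      (hmass _ _) (hmass _ _) (hXl _ _) (hXl _ _) hx hd (ht j hj) (htm j hj _ hk1)
      (htm j hj _ hk2)).const_mul (c := (Real.sqrt (2 ^ j) / n) ^ 2) (by positivity)
    convert! h using 2 with ω
    rw [hb, mul_pow]
  have j2 := (IntegralLE.sum (Finset.range J) fun j _ =>
    (IntegralLE.sum (Finset.range (2 ^ j)) fun k _ => i2 j k).const_mul (hv j).le).const_mul hW0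
  have j3 := (IntegralLE.sum (Finset.Ico J (m + 1)) fun j hj =>
    (IntegralLE.sum (Finset.range (2 ^ j)) fun k hk => i3 j hj k hk).const_mul
      (hv j).le).const_mul hW0
  refine ((((i1.add j2).add j3).add (IntegralLE.const hB.bound_nonneg)).const_mul (c := 4)
    (by norm_num)).lintegral_le_of_ae_le ?_
  filter_upwards [ae_good_points hβ hN] with ω hω
  obtain ⟨hfin, hD, h01⟩ := hω
  refine eLpNorm_sq_expansion_sub_le hf (b₀ := b₀ ω) (b := b ω) hJ ?_ hv hW hB
  filter_upwards [ae_notMem_dyadicRationals] with y hy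
  rw [haarEstimator_eq_sum hfin hD h01 hm, haar_fatherIndex hy,
    betaTilde_fatherIndex hn hfin hD (by rw [hm]; omega)]
  congr 1
  refine Finset.sum_congr rfl fun j hj => Finset.sum_congr rfl fun k _ => ?_
  rw [haar_motherIndex j k hy, betaTilde_motherIndex hn hfin hD j k (by
    rw [hm]; have := Finset.mem_range.1 hj; omega)]

/-! ### Bounds for the sums in the risk -/

theorem min_le_rpow_mul_rpow {a b a' b' θ : ℝ} (ha : 0 ≤ a) (hb : 0 ≤ b) (haa : a ≤ a')
    (hbb : b ≤ b') (h0 : 0 ≤ θ) (h1 : θ ≤ 1) : min a b ≤ a' ^ (1 - θ) * b' ^ θ := by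
  have hm : 0 ≤ min a b := le_min ha hb
  calc min a b = min a b ^ (1 - θ) * min a b ^ θ := by
        rw [← Real.rpow_add_of_nonneg hm (by linarith) h0]; simp
    _ ≤ a' ^ (1 - θ) * b' ^ θ := by
        have := ha.trans haa
        exact mul_le_mul (Real.rpow_le_rpow hm ((min_le_left _ _).trans haa) (by linarith))
          (Real.rpow_le_rpow hm ((min_le_right _ _).trans hbb) h0) (by positivity) (by positivity)

theorem exists_sum_rpow_le {r : ℝ} (hr : r < -1) :
    ∃ S : ℝ, ∀ K : ℕ, ∑ k ∈ Finset.range K, ((k : ℝ) + 1) ^ r ≤ S := by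
  have h := (summable_nat_add_iff 1).2 (Real.summable_nat_rpow.2 hr)
  refine ⟨∑' k : ℕ, ((k + 1 : ℕ) : ℝ) ^ r, fun K => ?_⟩
  have h2 := h.sum_le_tsum (Finset.range K) fun k _ => by positivity
  simpa using h2

theorem exists_sum_inv_two_pow_rpow_le {δ : ℝ} (hδ : 0 < δ) :
    ∃ W : ℝ, ∀ s : Finset ℕ, ∑ j ∈ s, 1 / ((2 : ℝ) ^ j) ^ δ ≤ W := by
  have e : ∀ j : ℕ, 1 / ((2 : ℝ) ^ j) ^ δ = ((2 : ℝ) ^ (-δ)) ^ j := by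
    intro j
    rw [one_div, ← Real.rpow_neg (by positivity), ← Real.rpow_natCast, ← Real.rpow_natCast,
      ← Real.rpow_mul (by norm_num), ← Real.rpow_mul (by norm_num), mul_comm]
  have h : Summable fun j : ℕ => ((2 : ℝ) ^ (-δ)) ^ j :=
    summable_geometric_of_lt_one (by positivity)
      (Real.rpow_lt_one_of_one_lt_of_neg (by norm_num) (by linarith))
  refine ⟨∑' j : ℕ, ((2 : ℝ) ^ (-δ)) ^ j, fun s => ?_⟩
  simp_rw [e]
  exact h.sum_le_tsum s fun j _ => by positivity

section Sums

variable {β γ θ : ℝ} {n : ℕ}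

theorem log_div_pos (hn : 2 ≤ n) : 0 < Real.log n / n := by
  have : (1 : ℝ) < n := by exact_mod_cast hn
  have := Real.log_pos this
  positivity

theorem log_div_le_one (n : ℕ) : Real.log n / n ≤ 1 :=
  div_le_one_of_le₀ (Real.log_le_self n.cast_nonneg) n.cast_nonneg

theorem one_half_le_log (hn : 2 ≤ n) : 1 / 2 ≤ Real.log n := by
  have h1 : Real.log 2 ≤ Real.log n := Real.log_le_log (by norm_num) (by exact_mod_cast hn)
  linarith [Real.log_two_gt_d9]

theorem one_div_le_rpow_log_div (hn : 2 ≤ n) (h1 : θ ≤ 1) :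
    1 / (n : ℝ) ≤ 2 * (Real.log n / n) ^ θ := by
  have hn' : (0 : ℝ) < n := by positivity
  have h2 : Real.log n / n ≤ (Real.log n / n) ^ θ :=
    Real.self_le_rpow_of_le_one (log_div_pos hn).le (log_div_le_one n) h1
  have h3 : 1 / (n : ℝ) ≤ 2 * (Real.log n / n) := by
    rw [mul_div_assoc', div_le_div_iff_of_pos_right hn']
    linarith [one_half_le_log hn]
  linarith

/-- The heart of the rate: the squared-coefficient bound `hA` and the variance bound `hB` are
interpolated with exponents `1 - θ` and `θ`. The condition `θ ≤ 1 / 3` makes the power of `k + 1` at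
most `-4 / 3`, and `720 = 4 * 180`. -/
theorem scaled_min_le (hβ : 0 ≤ β) (hβ1 : β ≤ 1 / 2) (hγ : 1 ≤ γ) (h0 : 0 ≤ θ) (h1 : θ ≤ 1 / 3)
    (hn : 2 ≤ n) {j k : ℕ} (hk : k < 2 ^ j) {p q : ℝ}
    (hp : p = n * dyadicMass (fBeta β) (j + 1) (2 * k))
    (hq : q = n * dyadicMass (fBeta β) (j + 1) (2 * k + 1)) :
    (Real.sqrt (2 ^ j) / n) ^ 2 * min ((p - q) ^ 2) (90 * (γ * Real.log n * (p + q)))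
      ≤ 720 * γ * (Real.log n / n) ^ θ * ((2 : ℝ) ^ j) ^ (-((1 - 2 * β) * (1 - θ) - β * θ))
        * ((k : ℝ) + 1) ^ (-(4 / 3) : ℝ) := by
  have hn' : (0 : ℝ) < n := by positivity
  have hε := log_div_pos hn
  have hlog : 0 < Real.log n := by linarith [one_half_le_log hn]
  have hZ : (0 : ℝ) < 2 ^ j := by positivity
  have hk1 : (0 : ℝ) < (k : ℝ) + 1 := by positivity
  have hF := dyadicMass_fBeta_le hβ hβ1 hk
  have hD := abs_dyadicMass_fBeta_sub_le hβ hβ1 hk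
  rw [dyadicMass_split (integrable_fBeta (by linarith)) j k] at hF
  have hF1 := dyadicMass_fBeta_nonneg β (j + 1) (2 * k)
  have hF2 := dyadicMass_fBeta_nonneg β (j + 1) (2 * k + 1)
  set F₁ := dyadicMass (fBeta β) (j + 1) (2 * k)
  set F₂ := dyadicMass (fBeta β) (j + 1) (2 * k + 1)
  set ε := Real.log n / n with hεd
  set Z : ℝ := 2 ^ j with hZd
  have hZ1 : Z ^ (2 * β - 1) = Z * (Z ^ (β - 1)) ^ 2 := by
    rw [← Real.rpow_natCast, ← Real.rpow_mul hZ.le]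
    nth_rewrite 2 [← Real.rpow_one Z]
    rw [← Real.rpow_add hZ]
    congr 1; push_cast; ring
  have hZ2 : Z ^ β = Z * Z ^ (β - 1) := by
    rw [Real.rpow_sub_one hZ.ne']; field_simp
  have hk2 : ((k : ℝ) + 1) ^ (-2 : ℝ) = 1 / (k + 1) ^ 2 := by
    rw [Real.rpow_neg hk1.le, one_div]; norm_num
  have hA : (Real.sqrt Z / n) ^ 2 * (p - q) ^ 2
      ≤ 4 * Z ^ (2 * β - 1) * ((k : ℝ) + 1) ^ (-2 : ℝ) := by
    have h2 : (F₁ - F₂) ^ 2 ≤ (2 * Z ^ (β - 1) / (k + 1)) ^ 2 :=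
      sq_le_sq.2 (hD.trans (le_abs_self _))
    calc (Real.sqrt Z / n) ^ 2 * (p - q) ^ 2 = Z * (F₁ - F₂) ^ 2 := by
          rw [hp, hq, div_pow, Real.sq_sqrt hZ.le]; field_simp
      _ ≤ Z * (2 * Z ^ (β - 1) / (k + 1)) ^ 2 := by gcongr
      _ = _ := by rw [hZ1, hk2]; field_simp; norm_num
  have hB : (Real.sqrt Z / n) ^ 2 * (90 * (γ * Real.log n * (p + q))) ≤ 180 * γ * ε * Z ^ β := by
    calc (Real.sqrt Z / n) ^ 2 * (90 * (γ * Real.log n * (p + q)))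
        = 90 * γ * ε * Z * (F₁ + F₂) := by
          rw [hp, hq, div_pow, Real.sq_sqrt hZ.le, hεd]; field_simp
      _ ≤ 90 * γ * ε * Z * (2 * Z ^ (β - 1)) := by gcongr
      _ = _ := by rw [hZ2]; ring
  have hp0 : 0 ≤ p := by rw [hp]; positivity
  have hq0 : 0 ≤ q := by rw [hq]; positivity
  rw [mul_min_of_nonneg _ _ (by positivity)]
  refine (min_le_rpow_mul_rpow (by positivity) (by positivity) hA hB h0 (by linarith)).trans ?_
  have e1 : (4 * Z ^ (2 * β - 1) * ((k : ℝ) + 1) ^ (-2 : ℝ)) ^ (1 - θ)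
      = 4 ^ (1 - θ) * Z ^ ((2 * β - 1) * (1 - θ)) * ((k : ℝ) + 1) ^ (-2 * (1 - θ)) := by
    rw [Real.mul_rpow (by positivity) (by positivity), Real.mul_rpow (by norm_num) (by positivity),
      ← Real.rpow_mul hZ.le, ← Real.rpow_mul hk1.le]
  have e2 : (180 * γ * ε * Z ^ β) ^ θ = (180 * γ) ^ θ * ε ^ θ * Z ^ (β * θ) := by
    rw [Real.mul_rpow (by positivity) (by positivity), Real.mul_rpow (by positivity) hε.le,
      ← Real.rpow_mul hZ.le]
  have b1 : (4 : ℝ) ^ (1 - θ) ≤ 4 := by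
    calc (4 : ℝ) ^ (1 - θ) ≤ 4 ^ (1 : ℝ) :=
          Real.rpow_le_rpow_of_exponent_le (by norm_num) (by linarith)
      _ = 4 := Real.rpow_one 4
  have b2 : (180 * γ) ^ θ ≤ 180 * γ := by
    calc (180 * γ) ^ θ ≤ (180 * γ) ^ (1 : ℝ) :=
          Real.rpow_le_rpow_of_exponent_le (by linarith) (by linarith)
      _ = _ := Real.rpow_one _
  have b3 : ((k : ℝ) + 1) ^ (-2 * (1 - θ)) ≤ ((k : ℝ) + 1) ^ (-(4 / 3) : ℝ) :=
    Real.rpow_le_rpow_of_exponent_le (by linarith [k.cast_nonneg (α := ℝ)]) (by linarith)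
  have e3 : Z ^ (-((1 - 2 * β) * (1 - θ) - β * θ))
      = Z ^ ((2 * β - 1) * (1 - θ)) * Z ^ (β * θ) := by
    rw [← Real.rpow_add hZ]; congr 1; ring
  rw [e1, e2, e3]
  calc 4 ^ (1 - θ) * Z ^ ((2 * β - 1) * (1 - θ)) * ((k : ℝ) + 1) ^ (-2 * (1 - θ))
        * ((180 * γ) ^ θ * ε ^ θ * Z ^ (β * θ))
      ≤ 4 * Z ^ ((2 * β - 1) * (1 - θ)) * ((k : ℝ) + 1) ^ (-(4 / 3) : ℝ)
        * ((180 * γ) * ε ^ θ * Z ^ (β * θ)) := by gcongr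
    _ = _ := by ring

/-- `2560 = 128 * 20`; this is the only source of the lower bound on `γ`. -/
theorem exp_log_le (hγ : 2560 ≤ γ) (hn : 2 ≤ n) :
    Real.exp (-(γ * Real.log n) / 128) ≤ 1 / (n : ℝ) ^ 20 := by
  have hn' : (0 : ℝ) < n := by positivity
  have hlog : 0 < Real.log n := by linarith [one_half_le_log hn]
  have e : 1 / (n : ℝ) ^ 20 = Real.exp (-(20 * Real.log n)) := by
    rw [Real.exp_neg, one_div, mul_comm, Real.exp_mul, Real.exp_log hn']
    norm_num
  rw [e]
  exact Real.exp_le_exp.2 (by nlinarith)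

theorem exp_mul_pow_four_le (hγ : 2560 ≤ γ) (hn : 2 ≤ n) {y : ℝ} (hy0 : 0 ≤ y) (hy : y ≤ 2 * n) :
    500 * Real.exp (-(γ * Real.log n) / 128) * (y + 1) ^ 4 ≤ 40500 / (n : ℝ) ^ 16 := by
  have hn' : (0 : ℝ) < n := by positivity
  have hn1 : (1 : ℝ) ≤ n := by exact_mod_cast (by omega : 1 ≤ n)
  calc 500 * Real.exp (-(γ * Real.log n) / 128) * (y + 1) ^ 4
      ≤ 500 * (1 / (n : ℝ) ^ 20) * (3 * n) ^ 4 := by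
        gcongr
        · exact exp_log_le hγ hn
        · linarith
    _ = _ := by field_simp; norm_num

/-- The decay `2 ^ (-2 δ j)` pays for the weight `2 ^ (δ j)` and leaves `2 ^ (-δ j)`. In the
remainder, `2 ^ j ≤ n ^ 4` makes all powers of `2 ^ j` cost at most `n ^ 16`, against the available
`n ^ (-18)`. -/
theorem level_risk_le (hβ : 0 ≤ β) (hβ1 : β ≤ 1 / 2) (hγ : 2560 ≤ γ) (h0 : 0 ≤ θ) (h1 : θ ≤ 1 / 3)
    (hn : 2 ≤ n) {j : ℕ} (hj : 2 ^ j ≤ n ^ 4) {δ : ℝ} (hδ1 : δ ≤ 1)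
    (hδ : 2 * δ = (1 - 2 * β) * (1 - θ) - β * θ) {S : ℝ}
    (hS : ∀ K : ℕ, ∑ k ∈ Finset.range K, ((k : ℝ) + 1) ^ (-(4 / 3) : ℝ) ≤ S) :
    ((2 : ℝ) ^ j) ^ δ * ∑ k ∈ Finset.range (2 ^ j), (Real.sqrt (2 ^ j) / n) ^ 2
        * diffRisk (γ * Real.log n) (n * dyadicMass (fBeta β) (j + 1) (2 * k))
              (n * dyadicMass (fBeta β) (j + 1) (2 * k + 1))
      ≤ (720 * γ * S * (Real.log n / n) ^ θ + 40500 / (n : ℝ) ^ 2) * (1 / ((2 : ℝ) ^ j) ^ δ) := by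
  have hn' : (0 : ℝ) < n := by positivity
  have hε := log_div_pos hn
  have hZ : (0 : ℝ) < 2 ^ j := by positivity
  have hZ1 : (1 : ℝ) ≤ 2 ^ j := one_le_pow₀ (by norm_num)
  have hZn : (2 : ℝ) ^ j ≤ n ^ 4 := by exact_mod_cast hj
  have hsq : Real.sqrt (2 ^ j) ^ 2 = 2 ^ j := Real.sq_sqrt hZ.le
  set ε := Real.log n / n with hεd
  have term : ∀ k ∈ Finset.range (2 ^ j), (Real.sqrt (2 ^ j) / n) ^ 2
        * diffRisk (γ * Real.log n) (n * dyadicMass (fBeta β) (j + 1) (2 * k))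
              (n * dyadicMass (fBeta β) (j + 1) (2 * k + 1))
      ≤ 720 * γ * ε ^ θ * ((2 : ℝ) ^ j) ^ (-(2 * δ)) * ((k : ℝ) + 1) ^ (-(4 / 3) : ℝ)
        + 2 ^ j / n ^ 2 * (40500 / (n : ℝ) ^ 16) := by
    intro k hk
    have hk' := Finset.mem_range.1 hk
    unfold diffRisk
    rw [mul_add, hδ]
    refine add_le_add (scaled_min_le hβ hβ1 (by linarith) h0 h1 hn hk' rfl rfl) ?_
    rw [div_pow, hsq]
    refine mul_le_mul_of_nonneg_left ?_ (by positivity)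
    have hF := dyadicMass_fBeta_le_two hβ hβ1 hk'
    have hF0 := dyadicMass_fBeta_nonneg β j k
    rw [← mul_add, ← dyadicMass_split (integrable_fBeta (by linarith))]
    refine exp_mul_pow_four_le hγ hn (by positivity) ?_
    nlinarith
  generalize hZd : (2 : ℝ) ^ j = Z at *
  have hZδ : Z ^ δ ≤ Z := by
    calc Z ^ δ ≤ Z ^ (1 : ℝ) := Real.rpow_le_rpow_of_exponent_le hZ1 hδ1
      _ = Z := Real.rpow_one Z
  have hZδ0 : 0 < Z ^ δ := by positivity
  have hcard : ((2 ^ j : ℕ) : ℝ) = Z := by rw [← hZd]; push_cast; rfl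
  calc _ ≤ Z ^ δ * (720 * γ * ε ^ θ * Z ^ (-(2 * δ)) * S
        + Z * (Z / n ^ 2 * (40500 / (n : ℝ) ^ 16))) := by
        refine mul_le_mul_of_nonneg_left ((Finset.sum_le_sum term).trans ?_) hZδ0.le
        rw [Finset.sum_add_distrib, ← Finset.mul_sum, Finset.sum_const, Finset.card_range,
          nsmul_eq_mul, hcard]
        gcongr
        exact hS _
    _ = 720 * γ * S * ε ^ θ * (Z ^ δ * Z ^ (-(2 * δ)))
        + 40500 / (n : ℝ) ^ 18 * (Z ^ δ * Z ^ 2) := by field_simp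
    _ ≤ 720 * γ * S * ε ^ θ * (1 / Z ^ δ) + 40500 / (n : ℝ) ^ 18 * (n ^ 16 * (1 / Z ^ δ)) := by
        have e1 : Z ^ δ * Z ^ (-(2 * δ)) = 1 / Z ^ δ := by
          rw [← Real.rpow_add hZ, one_div, ← Real.rpow_neg hZ.le]; congr 1; ring
        have e2 : Z ^ δ * Z ^ 2 ≤ n ^ 16 * (1 / Z ^ δ) := by
          rw [mul_one_div, le_div_iff₀ hZδ0]
          calc Z ^ δ * Z ^ 2 * Z ^ δ ≤ Z * Z ^ 2 * Z := by gcongr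
            _ = Z ^ 4 := by ring
            _ ≤ (n ^ 4) ^ 4 := by gcongr
            _ = n ^ 16 := by ring
        rw [e1]
        gcongr
    _ = _ := by field_simp

/-- The exponent `16` yields `(2 ^ j) ^ (-8)`. The weight, the number of terms, the normalization
and the target factor use at most four powers of `2 ^ j`, and the other four absorb `n ^ 16`; the
constant is `100 * 2 ^ 16`. -/
theorem high_level_risk_le (hn : 2 ≤ n) {j : ℕ} (hj : n ^ 4 ≤ 2 ^ j) {δ : ℝ} (hδ1 : δ ≤ 1) :
    ((2 : ℝ) ^ j) ^ δ * ∑ _k ∈ Finset.range (2 ^ j), (Real.sqrt (2 ^ j) / n) ^ 2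
        * (100 / (Real.sqrt (2 ^ j) / (2 * n)) ^ 16)
      ≤ 6553600 / (n : ℝ) ^ 2 * (1 / ((2 : ℝ) ^ j) ^ δ) := by
  have hn' : (0 : ℝ) < n := by positivity
  have hZ : (0 : ℝ) < 2 ^ j := by positivity
  have hZ1 : (1 : ℝ) ≤ 2 ^ j := one_le_pow₀ (by norm_num)
  have hZn : (n : ℝ) ^ 4 ≤ 2 ^ j := by exact_mod_cast hj
  have hsq : Real.sqrt (2 ^ j) ^ 2 = 2 ^ j := Real.sq_sqrt hZ.le
  rw [Finset.sum_const, Finset.card_range, nsmul_eq_mul]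
  push_cast
  generalize (2 : ℝ) ^ j = Z at *
  have hZδ : Z ^ δ ≤ Z := by
    calc Z ^ δ ≤ Z ^ (1 : ℝ) := Real.rpow_le_rpow_of_exponent_le hZ1 hδ1
      _ = Z := Real.rpow_one Z
  have hZδ0 : 0 < Z ^ δ := by positivity
  have hs16 : Real.sqrt Z ^ 16 = Z ^ 8 := by
    rw [show (16 : ℕ) = 2 * 8 by norm_num, pow_mul, hsq]
  rw [div_pow, div_pow, hsq, hs16, mul_one_div, le_div_iff₀ hZδ0]
  calc Z ^ δ * (Z * (Z / n ^ 2 * (100 / (Z ^ 8 / (2 * n) ^ 16)))) * Z ^ δ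
      ≤ Z * (Z * (Z / n ^ 2 * (100 / (Z ^ 8 / (2 * n) ^ 16)))) * Z := by gcongr
    _ = 6553600 / (n : ℝ) ^ 2 * ((n ^ 4) ^ 4 / Z ^ 4) := by field_simp; norm_num
    _ ≤ 6553600 / (n : ℝ) ^ 2 * 1 := by
        gcongr
        rw [div_le_one (by positivity)]
        gcongr
    _ = _ := mul_one _

theorem father_risk_le (hβ : 0 ≤ β) (hβ1 : β ≤ 1 / 2) (hγ : 2560 ≤ γ) (h1 : θ ≤ 1)
    (hn : 2 ≤ n) :
    (1 / (n : ℝ)) ^ 2 * diffRisk (γ * Real.log n) (n * dyadicMass (fBeta β) 0 0) 0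
      ≤ (180 * γ + 81000) * (Real.log n / n) ^ θ := by
  have hn' : (0 : ℝ) < n := by positivity
  have hn1 : (1 : ℝ) ≤ n := by exact_mod_cast (by omega : 1 ≤ n)
  have hlog : 0 < Real.log n := by linarith [one_half_le_log hn]
  have hF := dyadicMass_fBeta_le_two hβ hβ1 (j := 0) (k := 0) (by norm_num)
  have hF0 := dyadicMass_fBeta_nonneg β 0 0
  set F := dyadicMass (fBeta β) 0 0
  have h2 : Real.log n / n ≤ (Real.log n / n) ^ θ :=
    Real.self_le_rpow_of_le_one (log_div_pos hn).le (log_div_le_one n) h1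
  have h3 := one_div_le_rpow_log_div hn h1
  have h4 := exp_mul_pow_four_le hγ hn (y := n * F + 0) (by positivity) (by nlinarith)
  unfold diffRisk
  calc _ ≤ (1 / (n : ℝ)) ^ 2 * (90 * (γ * Real.log n * (n * 2 + 0)) + 40500 / (n : ℝ) ^ 16) := by
        gcongr
        refine (min_le_right _ _).trans ?_
        gcongr
    _ = 180 * γ * (Real.log n / n) + 40500 * (1 / n) * (1 / n ^ 17) := by field_simp; ring
    _ ≤ 180 * γ * (Real.log n / n) ^ θ + 40500 * (2 * (Real.log n / n) ^ θ) * 1 := by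
        gcongr
        rw [div_le_one (by positivity)]
        exact one_le_pow₀ hn1
    _ = _ := by ring

end Sums

/-! ### The maximal level -/

/-- With `c' = -c` the bound defining the maximal level is `(n / log n) ^ c`, at least `n / log n`
because `c ≥ 1`. Hence the level is nonnegative and fine enough for the bias. -/
theorem maxLevel_eq_natCast {c : ℝ} (hc : 1 ≤ c) {n : ℕ} (hn : 2 ≤ n) :
    ∃ m : ℕ, maxLevel c (-c) n = m ∧ 1 / (2 : ℝ) ^ (m + 1) ≤ Real.log n / n := by
  have hn' : (0 : ℝ) < n := by positivity
  have hε := log_div_pos hn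
  have hlog : 0 < Real.log n := by linarith [one_half_le_log hn]
  set ε := Real.log n / n with hεd
  have hr : (n : ℝ) ^ c * Real.log n ^ (-c) = (1 / ε) ^ c := by
    rw [hεd, one_div_div, Real.div_rpow hn'.le hlog.le, Real.rpow_neg hlog.le, div_eq_mul_inv]
  have h1 : 1 ≤ 1 / ε := by rw [le_div_iff₀ hε]; linarith [log_div_le_one n]
  have h2 : 1 / ε ≤ (1 / ε) ^ c := by
    calc 1 / ε = (1 / ε) ^ (1 : ℝ) := (Real.rpow_one _).symm
      _ ≤ _ := Real.rpow_le_rpow_of_exponent_le h1 hc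
  obtain ⟨-, h3⟩ := (maxLevel_eq_iff c (-c) hn (maxLevel c (-c) n)).1 rfl
  rw [hr] at h3
  have h4 : 0 < maxLevel c (-c) n + 1 := by
    have h5 : (2 : ℝ) ^ (0 : ℤ) < 2 ^ (maxLevel c (-c) n + 1) := by
      rw [zpow_zero]; linarith
    exact (zpow_lt_zpow_iff_right₀ (one_lt_two : (1 : ℝ) < 2)).1 h5
  refine ⟨(maxLevel c (-c) n).toNat, by omega, ?_⟩
  have h5 : maxLevel c (-c) n + 1 = (((maxLevel c (-c) n).toNat + 1 : ℕ) : ℤ) := by push_cast; omega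
  rw [h5, zpow_natCast] at h3
  rw [div_le_iff₀ (by positivity), ← div_le_iff₀' hε]
  linarith

/-- The finest level at which the coefficients are not negligible. -/
theorem exists_cutoff {m n : ℕ} (hn : 2 ≤ n) (hm : 1 / (2 : ℝ) ^ (m + 1) ≤ Real.log n / n) :
    ∃ J ≤ m + 1, 1 / (2 : ℝ) ^ J ≤ Real.log n / n ∧ (∀ j < J, 2 ^ j ≤ n ^ 4) ∧
      ∀ j, J ≤ j → j < m + 1 → n ^ 4 ≤ 2 ^ j := by
  have hn' : (0 : ℝ) < n := by positivity
  have hn1 : (1 : ℝ) ≤ n := by exact_mod_cast (by omega : 1 ≤ n)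
  set L := Nat.log 2 (n ^ 4) with hL
  have hlow : 2 ^ L ≤ n ^ 4 := Nat.pow_log_le_self 2 (by positivity)
  have hup : n ^ 4 < 2 ^ (L + 1) := Nat.lt_pow_succ_log_self (by norm_num) _
  have hup' : (n : ℝ) ^ 4 ≤ 2 ^ (L + 1) := by exact_mod_cast hup.le
  refine ⟨min (m + 1) (L + 1), min_le_left _ _, ?_, fun j hj => ?_, fun j hj hj2 => ?_⟩
  · rcases min_choice (m + 1) (L + 1) with h | h
    · rw [h]; exact hm
    · rw [h]
      have h2n : (2 : ℝ) ≤ n := by exact_mod_cast hn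
      calc 1 / (2 : ℝ) ^ (L + 1) ≤ 1 / (n : ℝ) ^ 4 := by gcongr
        _ = 1 / (n : ℝ) ^ 3 / n := by field_simp
        _ ≤ Real.log n / n := by
          gcongr
          refine le_trans ?_ (one_half_le_log hn)
          gcongr
          exact h2n.trans (le_self_pow₀ hn1 (by norm_num))
  · have : j ≤ L := by have := lt_min_iff.1 hj; omega
    exact (Nat.pow_le_pow_right (by norm_num) this).trans hlow
  · have : L + 1 ≤ j := by
      rcases min_le_iff.1 hj with h | h <;> omega
    exact hup.le.trans (Nat.pow_le_pow_right (by norm_num) this)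

/-- Since `β ≤ 1 / 2`, a cell at level `j + 1` has mass at most `2 / √(2 ^ j)`; this dictates the
choice `t = √(2 ^ j) / (2 n)` on the fine levels. -/
theorem sqrt_level_mul_dyadicMass_le {β : ℝ} (hβ : 0 ≤ β) (hβ1 : β ≤ 1 / 2) {n j k : ℕ}
    (hn : 0 < n) (hk : k < 2 ^ (j + 1)) :
    n * dyadicMass (fBeta β) (j + 1) k * (Real.sqrt (2 ^ j) / (2 * n)) ≤ 1 := by
  have hn' : (0 : ℝ) < n := by exact_mod_cast hn
  have h1 := dyadicMass_fBeta_le hβ hβ1 hk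
  have h2 : ((2 : ℝ) ^ (j + 1)) ^ (β - 1) ≤ 1 / Real.sqrt (2 ^ j) := by
    calc ((2 : ℝ) ^ (j + 1)) ^ (β - 1) ≤ ((2 : ℝ) ^ (j + 1)) ^ (-(1 / 2) : ℝ) :=
          Real.rpow_le_rpow_of_exponent_le (one_le_pow₀ (by norm_num)) (by linarith)
      _ = 1 / Real.sqrt (2 ^ (j + 1)) := by
          rw [Real.rpow_neg (by positivity), ← Real.sqrt_eq_rpow, one_div]
      _ ≤ _ := by
          gcongr
          · norm_num
          · omega
  have hs : 0 < Real.sqrt ((2 : ℝ) ^ j) := Real.sqrt_pos.2 (by positivity)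
  calc n * dyadicMass (fBeta β) (j + 1) k * (Real.sqrt (2 ^ j) / (2 * n))
      ≤ n * (2 * (1 / Real.sqrt (2 ^ j))) * (Real.sqrt (2 ^ j) / (2 * n)) := by
        gcongr
        linarith
    _ = 1 := by field_simp

theorem one_le_sqrt_level_div {n j : ℕ} (hn : 2 ≤ n) (hj : n ^ 4 ≤ 2 ^ j) :
    1 ≤ Real.sqrt (2 ^ j) / (2 * n) := by
  have hn' : (0 : ℝ) < n := by positivity
  have hn2 : (2 : ℝ) ≤ n := by exact_mod_cast hn
  have hj' : (n : ℝ) ^ 4 ≤ 2 ^ j := by exact_mod_cast hj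
  rw [one_le_div (by positivity)]
  refine Real.le_sqrt_of_sq_le (le_trans ?_ hj')
  have : (2 : ℝ) ^ 2 ≤ n ^ 2 := by gcongr
  calc (2 * (n : ℝ)) ^ 2 = 2 ^ 2 * (n : ℝ) ^ 2 := by ring
    _ ≤ (n : ℝ) ^ 2 * (n : ℝ) ^ 2 := by gcongr
    _ = (n : ℝ) ^ 4 := by ring

/-! ### Assembly of the bounds at the squared rate. -/

theorem sq_rate {s : ℝ} {n : ℕ} (hn : 2 ≤ n) : rate s n ^ 2 = (Real.log n / n) ^ (2 * s) := by
  rw [rate, ← Real.rpow_natCast, ← Real.rpow_mul (log_div_pos hn).le, mul_comm]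
  norm_num

theorem fBeta_mem_maxiset {s β : ℝ} (hs : 0 < s) (hβ : 0 < β)
    (hβ' : β ≤ (1 - 6 * s) / 2) {c γ : ℝ} (hc : 2560 ≤ c) (hγ : c < γ) :
    fBeta β ∈ maxiset.{u} (haarEstimator γ c (-c)) (rate s) := by
  have hβ1 : β < 1 / 2 := by linarith
  obtain ⟨S, hS⟩ := exists_sum_rpow_le (r := -(4 / 3)) (by norm_num)
  obtain ⟨S₂, hS₂⟩ := exists_sum_rpow_le (r := -2) (by norm_num)
  have hS₂' : ∀ K : ℕ, ∑ k ∈ Finset.range K, 1 / ((k : ℝ) + 1) ^ 2 ≤ S₂ := by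
    intro K
    refine le_trans (le_of_eq (Finset.sum_congr rfl fun k _ => ?_)) (hS₂ K)
    rw [Real.rpow_neg (by positivity), one_div]; norm_num
  -- Half of the decay exponent from `scaled_min_le` at `θ = 2 s`. It is positive because `1 - 2 β ≥
  -- 6 s` and `1 - 2 s ≥ 2 / 3` make the first product at least `4 s`, while the subtracted term is
  -- at most `s`.
  set δ : ℝ := ((1 - 2 * β) * (1 - 2 * s) - β * (2 * s)) / 2 with hδ
  have hδ0 : 0 < δ := by
    have h1 : 6 * s * (2 / 3) ≤ (1 - 2 * β) * (1 - 2 * s) := by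
      apply mul_le_mul <;> linarith
    have h2 : β * (2 * s) ≤ 1 / 2 * (2 * s) := by gcongr
    rw [hδ]; linarith
  have hδ1 : δ ≤ 1 := by
    have h1 : (1 - 2 * β) * (1 - 2 * s) ≤ 1 * 1 := by
      apply mul_le_mul <;> linarith
    have h2 : 0 ≤ β * (2 * s) := by positivity
    rw [hδ]; linarith
  obtain ⟨W, hW⟩ := exists_sum_inv_two_pow_rpow_le hδ0
  have hW0 : 0 ≤ W := by simpa using hW ∅
  have hS0 : 0 ≤ S := by simpa using hS 0
  have hS₂0 : 0 ≤ S₂ := by simpa using hS₂ 0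
  set D : ℝ := 4 + 1 / (1 - 2 * β) with hD
  have hD0 : 0 ≤ D := by
    have : 0 < 1 - 2 * β := by linarith
    positivity
  -- One summand per piece: father coefficient, levels below `J`, levels from `J` on, bias. Each
  -- inner `W` sums the residual decay, each outer one comes from Cauchy–Schwarz; `81000` and
  -- `13107200` contain the factor `2` of `1 / n ^ 2 ≤ 2 E`.
  set C : ℝ := 4 * ((180 * γ + 81000) + W * (W * (720 * γ * S + 81000)) + W * (W * 13107200)
    + D * S₂) with hC
  refine ⟨Filter.Eventually.of_forall (fBeta_nonneg β), memLp_one_fBeta (by linarith),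
    memLp_two_fBeta hβ1, C.toNNReal, ?_⟩
  intro n hn Ω _ P _ N hN
  have hn' : (0 : ℝ) < n := by positivity
  have hlog := one_half_le_log hn
  have hε := log_div_pos hn
  obtain ⟨m, hm, hm2⟩ := maxLevel_eq_natCast (c := c) (by linarith) hn
  obtain ⟨J, hJm, hJ, hlow, hhigh⟩ := exists_cutoff hn hm2
  have hx : 1280 ≤ γ * Real.log n := by nlinarith
  have hbias := integralLE_sq_dyadicAverage_sub hβ.le hβ1 J hS₂'
  refine (lintegral_eLpNorm_sq_haarEstimator_sub_le (d := 16) (J := J) (by linarith) (by omega) hN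
    hm (by push_cast; linarith) (by linarith) hJm (v := fun j => ((2 : ℝ) ^ j) ^ δ)
    (fun j => by positivity) hW hbias (t := fun j => Real.sqrt (2 ^ j) / (2 * n))
    (fun j hj => one_le_sqrt_level_div hn
      (hhigh j (Finset.mem_Ico.1 hj).1 (Finset.mem_Ico.1 hj).2))
    fun j _ k hk => sqrt_level_mul_dyadicMass_le hβ.le hβ1.le (by omega) hk).trans ?_
  have hCe : ((C.toNNReal : ℝ≥0∞)) * ENNReal.ofReal (rate s n) ^ 2
      = ENNReal.ofReal (C * (Real.log n / n) ^ (2 * s)) := by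
    have hC0 : 0 ≤ C := by
      have : 0 ≤ γ := by linarith
      positivity
    have hr : 0 ≤ rate s n := Real.rpow_nonneg hε.le _
    rw [← ENNReal.ofReal_pow hr, sq_rate hn, ENNReal.ofReal_mul hC0]
    rfl
  rw [hCe]
  refine ENNReal.ofReal_le_ofReal ?_
  set E := (Real.log n / n) ^ (2 * s) with hE
  have hE0 : 0 ≤ E := by positivity
  have h2n : 1 / (n : ℝ) ^ 2 ≤ 2 * E := by
    refine le_trans ?_ (one_div_le_rpow_log_div hn (by linarith))
    have hn1 : (1 : ℝ) ≤ n := by exact_mod_cast (by omega : 1 ≤ n)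
    gcongr
    exact le_self_pow₀ hn1 (by norm_num)
  have r0 := father_risk_le (γ := γ) (θ := 2 * s) hβ.le hβ1.le (by linarith) (by linarith) hn
  have r1 : ∑ j ∈ Finset.range J, ((2 : ℝ) ^ j) ^ δ * ∑ k ∈ Finset.range (2 ^ j),
      (Real.sqrt (2 ^ j) / n) ^ 2 * diffRisk (γ * Real.log n)
        (n * dyadicMass (fBeta β) (j + 1) (2 * k)) (n * dyadicMass (fBeta β) (j + 1) (2 * k + 1))
      ≤ W * (720 * γ * S + 81000) * E := by
    have hγ0 : 0 ≤ γ := by linarith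
    calc _ ≤ ∑ j ∈ Finset.range J,
          (720 * γ * S * E + 40500 / (n : ℝ) ^ 2) * (1 / ((2 : ℝ) ^ j) ^ δ) :=
          Finset.sum_le_sum fun j hj => level_risk_le hβ.le hβ1.le (by linarith) (by linarith)
            (by linarith) hn (hlow j (Finset.mem_range.1 hj)) hδ1 (by rw [hδ]; ring) hS
      _ ≤ (720 * γ * S * E + 40500 / (n : ℝ) ^ 2) * W := by
          rw [← Finset.mul_sum]
          exact mul_le_mul_of_nonneg_left (hW _) (by positivity)
      _ = (720 * γ * S * E + 40500 * (1 / (n : ℝ) ^ 2)) * W := by ring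
      _ ≤ (720 * γ * S * E + 40500 * (2 * E)) * W := by gcongr
      _ = _ := by ring
  have r2 : ∑ j ∈ Finset.Ico J (m + 1), ((2 : ℝ) ^ j) ^ δ * ∑ _k ∈ Finset.range (2 ^ j),
      (Real.sqrt (2 ^ j) / n) ^ 2 * (100 / (Real.sqrt (2 ^ j) / (2 * n)) ^ 16)
      ≤ W * 13107200 * E := by
    calc _ ≤ ∑ j ∈ Finset.Ico J (m + 1), 6553600 / (n : ℝ) ^ 2 * (1 / ((2 : ℝ) ^ j) ^ δ) :=
          Finset.sum_le_sum fun j hj => high_level_risk_le hn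
            (hhigh j (Finset.mem_Ico.1 hj).1 (Finset.mem_Ico.1 hj).2) hδ1
      _ ≤ 6553600 / (n : ℝ) ^ 2 * W := by
          rw [← Finset.mul_sum]
          exact mul_le_mul_of_nonneg_left (hW _) (by positivity)
      _ = 6553600 * (1 / (n : ℝ) ^ 2) * W := by ring
      _ ≤ 6553600 * (2 * E) * W := by gcongr
      _ = _ := by ring
  have r3 : D * ((2 : ℝ) ^ J) ^ (2 * β - 1) * S₂ ≤ D * S₂ * E := by
    have h1 : ((2 : ℝ) ^ J) ^ (2 * β - 1) ≤ E := by
      calc ((2 : ℝ) ^ J) ^ (2 * β - 1) = (1 / (2 : ℝ) ^ J) ^ (1 - 2 * β) := by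
            rw [one_div, Real.inv_rpow (by positivity), ← Real.rpow_neg (by positivity), neg_sub]
        _ ≤ (Real.log n / n) ^ (1 - 2 * β) :=
            Real.rpow_le_rpow (by positivity) hJ (by linarith)
        -- The base is at most `1`, so the larger exponent `1 - 2 β ≥ 6 s ≥ 2 s` gives the smaller
        -- power.
        _ ≤ E := Real.rpow_le_rpow_of_exponent_ge hε (log_div_le_one n) (by linarith)
    calc D * ((2 : ℝ) ^ J) ^ (2 * β - 1) * S₂ ≤ D * E * S₂ := by gcongr
      _ = _ := by ring
  calc _ ≤ 4 * ((180 * γ + 81000) * E + W * (W * (720 * γ * S + 81000) * E)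
        + W * (W * 13107200 * E) + D * S₂ * E) := by gcongr
    _ = C * E := by rw [hC]; ring

end HaarPoisson

theorem proposition2 (s β : ℝ) (hs : 0 < s) (hs' : s < 1 / 6)
    (hβ : 0 < β) (hβ' : β ≤ (1 - 6 * s) / 2) :
    (∃ c₀ : ℝ, ∀ c : ℝ, 1 ≤ c → c₀ ≤ c → ∀ γ : ℝ, c < γ →
      HaarPoisson.fBeta β ∈
        HaarPoisson.maxiset.{u} (HaarPoisson.haarEstimator γ c (-c)) (HaarPoisson.rate s)) ∧
    ¬ MemLp (HaarPoisson.fBeta β) ∞ volume :=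
  -- The threshold on `c` is an absolute constant, used only through `γ > c ≥ 2560`; it depends on
  -- neither `s` nor `β`.
  ⟨⟨2560, fun _ _ hc _ hγ => HaarPoisson.fBeta_mem_maxiset hs hβ hβ' hc hγ⟩,
    HaarPoisson.not_memLp_top_fBeta hβ⟩
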